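/- **Theorem 1.** For $g:\mathbb{R}^d\to\mathbb{R}$ let $$\|g\|_{\dot W^{s,p}(\mathbb{R}^d)}=\begin{cases}\left(\int_{\mathbb{R}^d}|g|^p\,dx\right)^{1/p}, & s=0,\\[2pt] \left(\int_{\mathbb{R}^d}\int_{\mathbb{R}^d}\frac{|g(x)-g(y)|^p}{|x-y|^{d+sp}}\,dx\,dy\right)^{1/p}, & 0<s<1,\\[2pt] \left(\int_{\mathbb{R}^d}|\nabla g|^p\,dx\right)^{1/p}, & s=1,\end{cases}$$ where $\nabla g$ is the weak gradient (for $s=1$ the value is $+\infty$ if $g$ has no locally integrable weak gradient). Let $d\ge1$ be an integer, $0\le s\le1$, $1<\gamma<\infty$, $1\le p,q<\infty$, $0<\alpha<d$ and $0<\beta_1,\beta_2<\infty$ be such that $$\beta_1p+2\beta_2q=1\quad\text{and}\quad(d-sp)\beta_1+(d+\alpha)\beta_2=\frac d\gamma.$$ (i) If $\beta_1\gamma+\beta_2\gamma\ge1$, then there is a constant $C>0$, independent of $g$, such that $$\|g\|_{L^\gamma(\mathbb{R}^d)}\le C\,\|g\|_{\dot W^{s,p}(\mathbb{R}^d)}^{\beta_1p}\left(\int_{\mathbb{R}^d}\int_{\mathbb{R}^d}\frac{|g(x)|^q|g(y)|^q}{|x-y|^{d-\alpha}}\,dx\,dy\right)^{\beta_2}$$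 for every $g\in L^1(\mathbb{R}^d)$ with compact support (both sides may be $+\infty$). (ii) The condition in (i) is optimal: if $\beta_1\gamma+\beta_2\gamma<1$, then for every constant $C\geq 0$ the inequality in (i) fails for some $g\in C_c^\infty(\mathbb{R}^d)$. -/

import Mathlib

open MeasureTheory
open scoped ENNReal NNReal ContDiff

noncomputable section

/-- `G` is a weak (distributional) gradient of `g` on `ℝᵈ`: both are locally integrable, and
`∫ g ∂ᵥφ = - ∫ φ ⟨G, v⟩` for every smooth compactly supported `φ` and every direction `v`. -/
def IsWeakGradient {d : ℕ} (g : EuclideanSpace ℝ (Fin d) → ℝ)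
    (G : EuclideanSpace ℝ (Fin d) → EuclideanSpace ℝ (Fin d)) : Prop :=
  LocallyIntegrable g volume ∧ LocallyIntegrable G volume ∧
    ∀ φ : EuclideanSpace ℝ (Fin d) → ℝ, ContDiff ℝ ∞ φ → HasCompactSupport φ →
      ∀ v : EuclideanSpace ℝ (Fin d),
        ∫ x, g x * fderiv ℝ φ x v = -∫ x, φ x * inner ℝ (G x) v

/-- The homogeneous Sobolev seminorm `‖g‖_{Ẇ^{s,p}(ℝᵈ)} ∈ [0, ∞]` for `0 ≤ s ≤ 1`: the `Lᵖ` norm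
for `s = 0`, the Gagliardo seminorm for `0 < s < 1`, and for `s = 1` the `Lᵖ` norm of the weak
gradient. The weak gradient is unique up to null sets, so the infimum is its `Lᵖ` norm if it exists,
and `∞` if it does not. -/
def sobolevSeminorm {d : ℕ} (s p : ℝ) (g : EuclideanSpace ℝ (Fin d) → ℝ) : ℝ≥0∞ :=
  if s = 0 then (∫⁻ x, ‖g x‖ₑ ^ p) ^ (1 / p)
  else if s = 1 then
    ⨅ (G : EuclideanSpace ℝ (Fin d) → EuclideanSpace ℝ (Fin d)) (_ : IsWeakGradient g G),
      (∫⁻ x, ‖G x‖ₑ ^ p) ^ (1 / p)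
  else (∫⁻ x, ∫⁻ y, ‖g x - g y‖ₑ ^ p / ‖x - y‖ₑ ^ ((d : ℝ) + s * p)) ^ (1 / p)

/-- The Coulomb term `∬ |g(x)|^q |g(y)|^q / |x - y|^{d - α} dx dy ∈ [0, ∞]`. -/
def coulombEnergy {d : ℕ} (α q : ℝ) (g : EuclideanSpace ℝ (Fin d) → ℝ) : ℝ≥0∞ :=
  ∫⁻ x, ∫⁻ y, ‖g x‖ₑ ^ q * ‖g y‖ₑ ^ q / ‖x - y‖ₑ ^ ((d : ℝ) - α)

end

/-! (i) Put `f = |g|^q` and replace `g` by `u = min |g| M`, which lies in `L^γ`; monotone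
convergence removes `M` at the end. Let `ν = ∫ u^γ`. The Coulomb energy dominates, up to a constant,
the integral of a density `H` (`ballEnergyDensity` with `b = 2d - α`) that satisfies `(∫_{B(x,r)}
f)² ≤ r^b H(x)`. Where `H ≥ Λ u^γ`, the integral of `u^γ` is at most `Λ⁻¹ ∫ H`, and `Λ` is chosen so
that this is at most `ν / 2` and can be absorbed.

Elsewhere `H < Λ u^γ`. At a point with `u` of size about `2^(k+1)`, the average of `u` over `B(x,r)`
is bounded once through `H` and once through `ν`. A weighted geometric mean of the two bounds
(`setLIntegral_ball_le_of_mul_le`) makes the average at most `2^k / 2` as soon as `r^(sp)` exceeds a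
multiple of `Λ^τ ν^(n/γ) 2^(k(p-γ))`. Then the layer of `u` between `2^k` and `2^(k+1)` has mean
oscillation at least `2^k / 2` at scale `r`, so the level set has measure at most a constant times
`2^(-kp) r^(sp) a_k`, where `a_k` is the share of that layer in the `p`-th power of the seminorm
(`measure_le_of_small_average`). For the least admissible `r` the powers of `2^k` cancel against the
weight `2^(kγ)`, and the shares `a_k` of disjoint layers add up to at most a multiple of the full
`p`-th power (`tsum_dyadicTrunc_sub_rpow_le`). Inserting `Λ = 2e/ν`, with `e` a bound for `∫ H`,
gives the inequality. The exponents that fit the scaling relations are `τ = β₂/β₁` and `n =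
(γ(β₁+β₂) - 1)/β₁`; the hypothesis of (i) says exactly that `n ≥ 0`.

(ii) For `m` copies of a bump placed very far apart, the `p`-th power of the seminorm and the
Coulomb energy grow at most like `m`, and so does the `γ`-th power of the `L^γ` norm, exactly. The
two sides compare as `m^(1/γ)` against `m^(β₁+β₂)`. -/

/-! ### Inequalities for lower integrals, scaling, and radial integrability. -/

section Generic

open Module Metric

/-- Jensen's inequality for powers of lower Lebesgue integrals. -/
theorem rpow_lintegral_le {X : Type*} [MeasurableSpace X] {ν : Measure X} {p : ℝ} (hp : 1 ≤ p)
    {w : X → ℝ≥0∞} (hw : AEMeasurable w ν) :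
    (∫⁻ x, w x ∂ν) ^ p ≤ ν Set.univ ^ (p - 1) * ∫⁻ x, w x ^ p ∂ν := by
  have h := eLpNorm'_le_eLpNorm'_mul_rpow_measure_univ (μ := ν) one_pos hp hw.aestronglyMeasurable
  simp only [eLpNorm', enorm_eq_self, ENNReal.rpow_one, div_one] at h
  have hp0 : 0 < p := by linarith
  calc _ ≤ ((∫⁻ a, w a ^ p ∂ν) ^ (1 / p) * ν Set.univ ^ (1 - 1 / p)) ^ p := by gcongr
    _ = _ := by
      rw [ENNReal.mul_rpow_of_nonneg _ _ hp0.le, ← ENNReal.rpow_mul, ← ENNReal.rpow_mul, mul_comm,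
        one_div_mul_cancel hp0.ne', ENNReal.rpow_one]
      congr 2
      field_simp

/-- Each term is at most the whole sum `S`, so `x_i ^ p ≤ x_i * S ^ (p - 1)`. -/
theorem tsum_rpow_le_rpow_tsum {ι : Type*} (x : ι → ℝ≥0∞) {p : ℝ} (hp : 1 ≤ p) :
    ∑' i, x i ^ p ≤ (∑' i, x i) ^ p := by
  have key : ∀ a b : ℝ≥0∞, a ≤ b → a ^ p ≤ a * b ^ (p - 1) := by
    intro a b hab
    calc a ^ p = a ^ (1 + (p - 1)) := by ring_nf
      _ = a ^ (1 : ℝ) * a ^ (p - 1) := ENNReal.rpow_add_of_nonneg _ _ zero_le_one (by linarith)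
      _ ≤ _ := by
        rw [ENNReal.rpow_one]
        exact mul_le_mul_right (ENNReal.rpow_le_rpow hab (by linarith)) a
  calc ∑' i, x i ^ p ≤ ∑' i, x i * (∑' i, x i) ^ (p - 1) :=
        ENNReal.tsum_le_tsum fun i => key _ _ (ENNReal.le_tsum i)
    _ = (∑' i, x i) ^ (1 : ℝ) * (∑' i, x i) ^ (p - 1) := by
        rw [ENNReal.tsum_mul_right, ENNReal.rpow_one]
    _ = _ := by rw [← ENNReal.rpow_add_of_nonneg _ _ zero_le_one (by linarith)]; ring_nf

theorem setLIntegral_ball_translate {E : Type*} [NormedAddCommGroup E] [MeasurableSpace E]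
    [BorelSpace E] (μ : Measure E) [μ.IsAddLeftInvariant] (f : E → ℝ≥0∞) (x : E) (r : ℝ) :
    ∫⁻ y in ball x r, f y ∂μ = ∫⁻ h in ball 0 r, f (x + h) ∂μ := by
  rw [← lintegral_indicator measurableSet_ball, ← lintegral_indicator measurableSet_ball,
    ← lintegral_add_left_eq_self _ x]
  congr 1
  ext y
  simp only [Set.indicator, mem_ball, dist_eq_norm, add_sub_cancel_left, sub_zero]

variable {E : Type*} [NormedAddCommGroup E] [NormedSpace ℝ E] [FiniteDimensional ℝ E]
  [MeasurableSpace E] [BorelSpace E] (μ : Measure E) [μ.IsAddHaarMeasure]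

theorem lintegral_comp_smul_addHaar (f : E → ℝ≥0∞) {r : ℝ} (hr : 0 < r) :
    ENNReal.ofReal (r ^ finrank ℝ E) * ∫⁻ x, f (r • x) ∂μ = ∫⁻ x, f x ∂μ := by
  have h := lintegral_map_equiv (μ := μ) f
    (Homeomorph.smul (isUnit_iff_ne_zero.2 hr.ne').unit : E ≃ₜ E).toMeasurableEquiv
  have h2 : Measure.map (Homeomorph.smul (isUnit_iff_ne_zero.2 hr.ne').unit :
      E ≃ₜ E).toMeasurableEquiv μ = ENNReal.ofReal |(r ^ finrank ℝ E)⁻¹| • μ :=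
    Measure.map_addHaar_smul μ hr.ne'
  rw [h2, lintegral_smul_measure, abs_of_pos (by positivity)] at h
  change _ = ∫⁻ x, f (r • x) ∂μ at h
  rw [← h, smul_eq_mul, ← mul_assoc, ← ENNReal.ofReal_mul (by positivity),
    mul_inv_cancel₀ (by positivity)]
  simp

theorem setLIntegral_ball_eq_smul (f : E → ℝ≥0∞) {r : ℝ} (hr : 0 < r) :
    ∫⁻ x in ball 0 r, f x ∂μ =
      ENNReal.ofReal (r ^ finrank ℝ E) * ∫⁻ x in ball 0 1, f (r • x) ∂μ := by
  rw [← lintegral_indicator measurableSet_ball, ← lintegral_indicator measurableSet_ball,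
    ← lintegral_comp_smul_addHaar μ _ hr]
  congr 2
  ext x
  have : r • x ∈ ball (0 : E) r ↔ x ∈ ball (0 : E) 1 := by
    simp only [mem_ball_zero_iff, norm_smul, Real.norm_eq_abs, abs_of_pos hr]
    constructor <;> intro h <;> nlinarith
  by_cases hx : x ∈ ball (0 : E) 1
  · rw [Set.indicator_of_mem hx, Set.indicator_of_mem (this.2 hx)]
  · rw [Set.indicator_of_notMem hx, Set.indicator_of_notMem (mt this.1 hx)]

theorem setLIntegral_ball_enorm_rpow_lt_top (hd : 1 ≤ finrank ℝ E) {b : ℝ} (hb : b < finrank ℝ E)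
    (R : ℝ) : ∫⁻ x in ball (0 : E) R, ‖x‖ₑ ^ (-b) ∂μ < ⊤ := by
  have : Nontrivial E := nontrivial_of_finrank_pos (R := ℝ) (by omega)
  have h := integrableOn_ball_of_norm_le_rpow (μ := μ) hd (f := fun x : E => ‖x‖ ^ (-b)) (C := 1)
    (r := R) hb (by
      filter_upwards with x
      rw [one_mul, Real.norm_of_nonneg (by positivity)])
    (measurable_norm.pow_const _).aestronglyMeasurable
  have h2 := h.2
  rw [hasFiniteIntegral_iff_enorm] at h2
  refine lt_of_eq_of_lt (setLIntegral_congr_fun_ae measurableSet_ball ?_) h2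
  have h0 : ∀ᵐ x ∂μ, x ≠ (0 : E) := by simp [ae_iff]
  filter_upwards [h0] with x hx _
  rw [Real.enorm_of_nonneg (by positivity), ← ofReal_norm,
    ENNReal.ofReal_rpow_of_pos (norm_pos_iff.2 hx)]

theorem setLIntegral_compl_ball_enorm_rpow_lt_top {b : ℝ} (hb : finrank ℝ E < b)
    {R : ℝ} (hR : 0 < R) : ∫⁻ x in (ball (0 : E) R)ᶜ, ‖x‖ₑ ^ (-b) ∂μ < ⊤ := by
  have hb0 : 0 < b := lt_of_le_of_lt (Nat.cast_nonneg _) hb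
  have h := finite_integral_one_add_norm (μ := μ) hb
  have hc : 0 < 1 + R⁻¹ := by positivity
  calc ∫⁻ x in (ball (0 : E) R)ᶜ, ‖x‖ₑ ^ (-b) ∂μ
      ≤ ∫⁻ x in (ball (0 : E) R)ᶜ, ENNReal.ofReal ((1 + R⁻¹) ^ b) *
          ENNReal.ofReal ((1 + ‖x‖) ^ (-b)) ∂μ := by
        refine setLIntegral_mono' measurableSet_ball.compl fun x hx => ?_
        have hx' : R ≤ ‖x‖ := by simpa using hx
        have hx0 : 0 < ‖x‖ := by linarith
        rw [← ofReal_norm, ENNReal.ofReal_rpow_of_pos hx0,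
          ← ENNReal.ofReal_mul (by positivity)]
        refine ENNReal.ofReal_le_ofReal ?_
        rw [Real.rpow_neg hx0.le, Real.rpow_neg (by positivity), ← div_eq_mul_inv,
          inv_eq_one_div, div_le_div_iff₀ (by positivity) (by positivity), one_mul,
          ← Real.mul_rpow hc.le hx0.le]
        refine Real.rpow_le_rpow (by positivity) ?_ hb0.le
        have : 1 ≤ R⁻¹ * ‖x‖ := by
          rw [inv_mul_eq_div, le_div_iff₀ hR]; linarith
        linarith
    _ ≤ ∫⁻ x, ENNReal.ofReal ((1 + R⁻¹) ^ b) * ENNReal.ofReal ((1 + ‖x‖) ^ (-b)) ∂μ :=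
        setLIntegral_le_lintegral _ _
    _ < ⊤ := by
        rw [lintegral_const_mul' _ _ ENNReal.ofReal_ne_top]
        exact ENNReal.mul_lt_top ENNReal.ofReal_lt_top h

/-! ### Dyadic layers of a function. -/

/-- The part of `t` lying between the dyadic levels `2 ^ k` and `2 ^ (k + 1)`. -/
noncomputable def dyadicTrunc (k : ℤ) (t : ℝ) : ℝ := min t (2 ^ (k + 1)) - min t (2 ^ k)

theorem continuous_dyadicTrunc (k : ℤ) : Continuous (dyadicTrunc k) := by
  unfold dyadicTrunc; fun_prop

theorem two_zpow_succ (k : ℤ) : (2 : ℝ) ^ (k + 1) = 2 * 2 ^ k := by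
  rw [zpow_add_one₀ two_ne_zero, mul_comm]

theorem dyadicTrunc_nonneg (k : ℤ) (t : ℝ) : 0 ≤ dyadicTrunc k t := by
  have h : (0 : ℝ) < 2 ^ k := by positivity
  unfold dyadicTrunc
  rw [two_zpow_succ, sub_nonneg]
  exact min_le_min_left _ (by linarith)

theorem dyadicTrunc_le (k : ℤ) {t : ℝ} (ht : 0 ≤ t) : dyadicTrunc k t ≤ t := by
  have h : (0 : ℝ) < 2 ^ k := by positivity
  have := min_le_left t ((2 : ℝ) ^ (k + 1))
  have := le_min ht h.le
  unfold dyadicTrunc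
  linarith

theorem dyadicTrunc_of_le {k : ℤ} {t : ℝ} (ht : 2 ^ (k + 1) ≤ t) : dyadicTrunc k t = 2 ^ k := by
  have h : (0 : ℝ) < 2 ^ k := by positivity
  unfold dyadicTrunc
  rw [min_eq_right ht]
  rw [two_zpow_succ] at ht ⊢
  rw [min_eq_right (by linarith)]
  ring

/-- The layer map has slope one between its two levels and is constant outside. Written as a measure
of intervals, the increments of different layers become additive. -/
theorem enorm_dyadicTrunc_sub {a b : ℝ} (hab : b ≤ a) (k : ℤ) :
    ‖dyadicTrunc k a - dyadicTrunc k b‖ₑ =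
      volume (Set.Ioc b a ∩ Set.Ioc ((2 : ℝ) ^ k) (2 ^ (k + 1))) := by
  have h : (0 : ℝ) < 2 ^ k := by positivity
  rw [Set.Ioc_inter_Ioc, Real.volume_Ioc, Real.enorm_eq_ofReal_abs]
  unfold dyadicTrunc
  rw [two_zpow_succ]
  generalize (2 : ℝ) ^ k = c at h
  have e : ENNReal.ofReal (min a (2 * c) - max b c)
      = ENNReal.ofReal (max (min a (2 * c) - max b c) 0) := by
    rw [ENNReal.ofReal_max]; simp
  rw [e]
  congr 1
  grind

/-- The increments are lengths of disjoint pieces of the interval between `a` and `b`, so they sum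
to at most `|a - b|`; for `p ≥ 1` the `ℓ^p` norm is at most the `ℓ^1` norm. This lets the levels be
estimated separately and summed without loss. -/
theorem tsum_dyadicTrunc_sub_rpow_le (a b : ℝ) {p : ℝ} (hp : 1 ≤ p) :
    ∑' k, ‖dyadicTrunc k a - dyadicTrunc k b‖ₑ ^ p ≤ ‖a - b‖ₑ ^ p := by
  refine (tsum_rpow_le_rpow_tsum _ hp).trans (ENNReal.rpow_le_rpow ?_ (by linarith))
  wlog hab : b ≤ a generalizing a b
  · have := this b a (le_of_not_ge hab)
    rw [← enorm_neg (a - b), neg_sub]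
    convert this using 3 with k
    rw [← enorm_neg, neg_sub]
  simp_rw [enorm_dyadicTrunc_sub hab]
  have hd : Pairwise (Function.onFun Disjoint
      fun k : ℤ => Set.Ioc b a ∩ Set.Ioc ((2 : ℝ) ^ k) (2 ^ (k + 1))) := by
    intro i j hij
    refine Disjoint.mono Set.inter_subset_right Set.inter_subset_right ?_
    have := (zpow_right_mono₀ (one_le_two (α := ℝ))).pairwise_disjoint_on_Ioc_succ hij
    simpa [Function.onFun] using this
  rw [← measure_iUnion hd fun k => measurableSet_Ioc.inter measurableSet_Ioc,
    Real.enorm_of_nonneg (sub_nonneg.2 hab), ← Real.volume_Ioc]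
  exact measure_mono (Set.iUnion_subset fun k => Set.inter_subset_left)

end Generic

/-! ### A density controlling ball masses, and its comparison with the Coulomb energy. -/

section Kernel

open Module Metric

variable {E : Type*} [NormedAddCommGroup E] [NormedSpace ℝ E] [FiniteDimensional ℝ E]
  [MeasurableSpace E] [BorelSpace E] (μ : Measure E)

/-- A density on `E` that controls all the squared ball averages of `f` and integrates to a
multiple of the Coulomb energy of `f`. -/
noncomputable def ballEnergyDensity (b : ℝ) (f : E → ℝ≥0∞) (x : E) : ℝ≥0∞ :=
  ∫⁻ y, ∫⁻ z, f y * f z * (max ‖x - y‖ₑ ‖x - z‖ₑ) ^ (-b) ∂μ ∂μ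

theorem measurable_ballEnergyDensity [SFinite μ] (b : ℝ) {f : E → ℝ≥0∞} (hf : Measurable f) :
    Measurable (ballEnergyDensity μ b f) := by
  unfold ballEnergyDensity
  fun_prop

/-- For `y` and `z` in `ball x r` the maximum in the kernel is at most `r`, hence `r ^ b` times the
kernel is at least one there. -/
theorem sq_setLIntegral_ball_le {E : Type*} [NormedAddCommGroup E] [MeasurableSpace E]
    [BorelSpace E] (μ : Measure E) {b : ℝ} (hb : 0 ≤ b) {f : E → ℝ≥0∞} (hf : Measurable f)
    (x : E) {r : ℝ} (hr : 0 < r) :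
    (∫⁻ y in ball x r, f y ∂μ) ^ (2 : ℝ) ≤ ENNReal.ofReal r ^ b * ballEnergyDensity μ b f x := by
  have hr' : ENNReal.ofReal r ^ b ≠ ⊤ := (ENNReal.rpow_lt_top_of_nonneg hb ENNReal.ofReal_ne_top).ne
  have hr0 : ENNReal.ofReal r ^ b ≠ 0 :=
    (ENNReal.rpow_pos (ENNReal.ofReal_pos.2 hr) ENNReal.ofReal_ne_top).ne'
  have key : ∀ y ∈ ball x r, ∀ z ∈ ball x r,
      f y * f z ≤ ENNReal.ofReal r ^ b * (f y * f z * (max ‖x - y‖ₑ ‖x - z‖ₑ) ^ (-b)) := by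
    intro y hy z hz
    have hm : max ‖x - y‖ₑ ‖x - z‖ₑ ≤ ENNReal.ofReal r := by
      rw [mem_ball', dist_eq_norm] at hy hz
      simp only [← ofReal_norm]
      exact max_le (ENNReal.ofReal_le_ofReal hy.le) (ENNReal.ofReal_le_ofReal hz.le)
    have h1 : 1 ≤ ENNReal.ofReal r ^ b * (max ‖x - y‖ₑ ‖x - z‖ₑ) ^ (-b) := by
      rw [ENNReal.rpow_neg, ← ENNReal.mul_inv_cancel hr0 hr']
      gcongr
    calc f y * f z ≤ f y * f z * (ENNReal.ofReal r ^ b * (max ‖x - y‖ₑ ‖x - z‖ₑ) ^ (-b)) :=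
          le_mul_of_one_le_right' h1
      _ = _ := by ring
  calc (∫⁻ y in ball x r, f y ∂μ) ^ (2 : ℝ)
      = ∫⁻ y in ball x r, ∫⁻ z in ball x r, f y * f z ∂μ ∂μ := by
        simp_rw [lintegral_const_mul _ hf]
        rw [lintegral_mul_const _ hf, ENNReal.rpow_two, sq]
    _ ≤ ∫⁻ y in ball x r, ∫⁻ z in ball x r,
          ENNReal.ofReal r ^ b * (f y * f z * (max ‖x - y‖ₑ ‖x - z‖ₑ) ^ (-b)) ∂μ ∂μ :=
        setLIntegral_mono' measurableSet_ball fun y hy =>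
          setLIntegral_mono' measurableSet_ball fun z hz => key y hy z hz
    _ ≤ ∫⁻ y, ∫⁻ z,
          ENNReal.ofReal r ^ b * (f y * f z * (max ‖x - y‖ₑ ‖x - z‖ₑ) ^ (-b)) ∂μ ∂μ :=
        (setLIntegral_le_lintegral _ _).trans
          (lintegral_mono fun y => setLIntegral_le_lintegral _ _)
    _ = _ := by
        simp_rw [lintegral_const_mul' _ _ hr']
        rfl

variable [μ.IsAddHaarMeasure]

theorem lintegral_max_enorm_rpow_lt_top {b : ℝ} (hb : finrank ℝ E < b) :
    ∫⁻ x : E, (max ‖x‖ₑ (ENNReal.ofReal (1 / 2))) ^ (-b) ∂μ < ⊤ := by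
  have hb0 : 0 < b := lt_of_le_of_lt (Nat.cast_nonneg _) hb
  rw [← lintegral_add_compl _ (measurableSet_ball (x := (0 : E)) (ε := 1))]
  refine ENNReal.add_lt_top.2 ⟨?_, ?_⟩
  · calc _ ≤ ∫⁻ x in ball (0 : E) 1, ENNReal.ofReal (1 / 2) ^ (-b) ∂μ := by
          refine lintegral_mono fun x => ?_
          simp only [ENNReal.rpow_neg]
          gcongr
          exact le_max_right _ _
      _ < ⊤ := by
          rw [setLIntegral_const]
          refine ENNReal.mul_lt_top ?_ measure_ball_lt_top
          rw [ENNReal.ofReal_rpow_of_pos (by norm_num)]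
          exact ENNReal.ofReal_lt_top
  · refine lt_of_le_of_lt (lintegral_mono fun x => ?_)
      (setLIntegral_compl_ball_enorm_rpow_lt_top μ hb one_pos)
    simp only [ENNReal.rpow_neg]
    gcongr
    exact le_max_left _ _

/-- One of `|x - y|`, `|x - z|` is at least half of `R = |y - z|`. After translating `y` to the
origin the maximum dominates `max |x| (R/2)`, and scaling by `R` leaves a fixed convergent integral
times `R ^ (d - b)`, where `d` is the dimension. -/
theorem lintegral_max_enorm_sub_le {b : ℝ} (hb : finrank ℝ E < b) (y z : E) :
    ∫⁻ x, (max ‖x - y‖ₑ ‖x - z‖ₑ) ^ (-b) ∂μ ≤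
      (∫⁻ x : E, (max ‖x‖ₑ (ENNReal.ofReal (1 / 2))) ^ (-b) ∂μ + 1) /
        ‖y - z‖ₑ ^ (b - finrank ℝ E) := by
  have hb0 : 0 < b := lt_of_le_of_lt (Nat.cast_nonneg _) hb
  -- On the diagonal the right side is a quotient by zero; the `+ 1` keeps its numerator nonzero, so
  -- that the quotient is `⊤`.
  rcases eq_or_ne y z with rfl | hyz
  · rw [sub_self, enorm_zero, ENNReal.zero_rpow_of_pos (by linarith), ENNReal.div_zero (by simp)]
    exact le_top
  have hR : 0 < ‖y - z‖ := norm_pos_iff.2 (sub_ne_zero.2 hyz)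
  have hRe : ‖y - z‖ₑ = ENNReal.ofReal ‖y - z‖ := (ofReal_norm _).symm
  set R := ‖y - z‖ with hRdef
  have half : ∀ x : E, ENNReal.ofReal (R / 2) ≤ max ‖x‖ₑ ‖x + y - z‖ₑ := by
    intro x
    rw [← ofReal_norm, ← ofReal_norm]
    have : R ≤ ‖x‖ + ‖x + y - z‖ := by
      rw [hRdef]
      calc ‖y - z‖ = ‖(x + y - z) - x‖ := by congr 1; abel
        _ ≤ ‖x + y - z‖ + ‖x‖ := norm_sub_le _ _
        _ = _ := add_comm _ _
    rcases le_total (R / 2) ‖x‖ with h | h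
    · exact le_max_of_le_left (ENNReal.ofReal_le_ofReal h)
    · exact le_max_of_le_right (ENNReal.ofReal_le_ofReal (by linarith))
  calc ∫⁻ x, (max ‖x - y‖ₑ ‖x - z‖ₑ) ^ (-b) ∂μ
      = ∫⁻ x, (max ‖x‖ₑ ‖x + y - z‖ₑ) ^ (-b) ∂μ := by
        rw [← lintegral_add_right_eq_self _ y]
        simp
    _ ≤ ∫⁻ x, (max ‖x‖ₑ (ENNReal.ofReal (R / 2))) ^ (-b) ∂μ := by
        refine lintegral_mono fun x => ?_
        simp only [ENNReal.rpow_neg]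
        exact ENNReal.inv_le_inv.2 (ENNReal.rpow_le_rpow (max_le (le_max_left _ _) (half x)) hb0.le)
    _ = ENNReal.ofReal (R ^ finrank ℝ E) *
          ∫⁻ x, (ENNReal.ofReal R) ^ (-b) * (max ‖x‖ₑ (ENNReal.ofReal (1 / 2))) ^ (-b) ∂μ := by
        rw [← lintegral_comp_smul_addHaar μ _ hR]
        congr 2
        ext x
        rw [← ENNReal.mul_rpow_of_ne_top ENNReal.ofReal_ne_top (by simp), enorm_smul,
          Real.enorm_of_nonneg hR.le, mul_max, ← ENNReal.ofReal_mul hR.le]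
        congr 3
        ring_nf
    _ = (∫⁻ x : E, (max ‖x‖ₑ (ENNReal.ofReal (1 / 2))) ^ (-b) ∂μ) /
        ‖y - z‖ₑ ^ (b - finrank ℝ E) := by
        have e1 : ENNReal.ofReal R ^ (-b) = ENNReal.ofReal (R ^ (-b)) :=
          ENNReal.ofReal_rpow_of_pos hR
        rw [e1, lintegral_const_mul' _ _ ENNReal.ofReal_ne_top, ← mul_assoc,
          ← ENNReal.ofReal_mul (by positivity), hRe, ENNReal.ofReal_rpow_of_pos hR,
          ENNReal.div_eq_inv_mul, ← ENNReal.ofReal_inv_of_pos (by positivity),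
          ← Real.rpow_natCast, ← Real.rpow_add hR, ← Real.rpow_neg hR.le]
        congr 3
        ring
    _ ≤ _ := by gcongr; exact le_self_add

/-- By Tonelli the kernel can be integrated in `x` first. For `b = 2d - α` the resulting power of
`|y - z|` is the Coulomb one. -/
theorem lintegral_ballEnergyDensity_le {b : ℝ} (hb : finrank ℝ E < b) {f : E → ℝ≥0∞}
    (hf : Measurable f) :
    ∫⁻ x, ballEnergyDensity μ b f x ∂μ ≤
      (∫⁻ x : E, (max ‖x‖ₑ (ENNReal.ofReal (1 / 2))) ^ (-b) ∂μ + 1) *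
        ∫⁻ y, ∫⁻ z, f y * f z / ‖y - z‖ₑ ^ (b - finrank ℝ E) ∂μ ∂μ := by
  set C := ∫⁻ x : E, (max ‖x‖ₑ (ENNReal.ofReal (1 / 2))) ^ (-b) ∂μ + 1 with hC
  have hCt : C ≠ ⊤ := by
    rw [hC]; exact ENNReal.add_ne_top.2 ⟨(lintegral_max_enorm_rpow_lt_top μ hb).ne, by simp⟩
  calc ∫⁻ x, ballEnergyDensity μ b f x ∂μ
      = ∫⁻ y, ∫⁻ z, f y * f z * ∫⁻ x, (max ‖x - y‖ₑ ‖x - z‖ₑ) ^ (-b) ∂μ ∂μ ∂μ := by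
        unfold ballEnergyDensity
        rw [lintegral_lintegral_swap (by fun_prop)]
        refine lintegral_congr fun y => ?_
        rw [lintegral_lintegral_swap (by fun_prop)]
        refine lintegral_congr fun z => ?_
        rw [lintegral_const_mul _ (by fun_prop)]
    _ ≤ ∫⁻ y, ∫⁻ z, C * (f y * f z / ‖y - z‖ₑ ^ (b - finrank ℝ E)) ∂μ ∂μ := by
        refine lintegral_mono fun y => lintegral_mono fun z => ?_
        calc _ ≤ f y * f z * (C / ‖y - z‖ₑ ^ (b - finrank ℝ E)) :=
              mul_le_mul_right (lintegral_max_enorm_sub_le μ hb y z) _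
          _ = _ := by simp only [div_eq_mul_inv]; ring
    _ = _ := by simp_rw [lintegral_const_mul' _ _ hCt]

end Kernel

/-! ### Measure of level sets from oscillation at a given scale. -/

section Level

open Module Metric

variable {E : Type*} [NormedAddCommGroup E] [NormedSpace ℝ E] [FiniteDimensional ℝ E]
  [MeasurableSpace E] [BorelSpace E] (μ : Measure E) [μ.IsAddHaarMeasure]

/-- The `p`-th power of the `Lᵖ` distance between `w` and its translate by `h`. -/
noncomputable def translateDist {E : Type*} [NormedAddCommGroup E] [MeasurableSpace E]
    (μ : Measure E) (p : ℝ) (w : E → ℝ) (h : E) : ℝ≥0∞ :=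
  ∫⁻ x, ‖w (x + h) - w x‖ₑ ^ p ∂μ

/-- The dyadic truncations of `u` have smoothness `s` on balls of radius `2 ^ j`, `j ≥ J`, with
constants whose sum over the truncation levels is at most `N`. -/
def HasDyadicSmoothness (s p : ℝ) (u : E → ℝ) (N : ℝ≥0∞) : Prop :=
  ∀ J : ℤ, ∃ a : ℤ → ℝ≥0∞, ∑' k, a k ≤ N ∧ ∀ k j, J ≤ j →
    ∫⁻ h in ball (0 : E) (2 ^ j), translateDist μ p (fun x => dyadicTrunc k (u x)) h ∂μ ≤
      ENNReal.ofReal (((2 : ℝ) ^ j) ^ (finrank ℝ E + s * p)) * a k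

theorem measurable_translateDist (p : ℝ) {w : E → ℝ} (hw : Measurable w) :
    Measurable (translateDist μ p w) := by
  unfold translateDist
  fun_prop

variable {μ} in
-- On `A` the layer has its full height `2 ^ k`, while its average over the ball, being at most that
-- of `u`, is at most half of this. So the mean increment from a point of `A` is at least `2 ^ k /
-- 2`. Jensen gives the same for `p`-th powers, and integrating over `A` with Tonelli produces the
-- translates.
theorem mul_measure_le_of_small_average {p : ℝ} (hp : 1 ≤ p) {u : E → ℝ} (hu : Measurable u)
    (hu0 : ∀ x, 0 ≤ u x) {k : ℤ} {r : ℝ} (hr : 0 < r) {A : Set E} (hA : MeasurableSet A)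
    (hAu : ∀ x ∈ A, 2 ^ (k + 1) ≤ u x)
    (hav : ∀ x ∈ A, ∫⁻ y in ball x r, ‖u y‖ₑ ∂μ ≤ ENNReal.ofReal (2 ^ k / 2) * μ (ball 0 r)) :
    ENNReal.ofReal ((2 ^ k / 2) ^ p) * μ (ball 0 r) * μ A ≤
      ∫⁻ h in ball (0 : E) r, translateDist μ p (fun x => dyadicTrunc k (u x)) h ∂μ := by
  have hk : (0 : ℝ) < 2 ^ k := by positivity
  set m := μ (ball (0 : E) r) with hm
  have hm0 : m ≠ 0 := (measure_ball_pos μ _ hr).ne'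
  have hmt : m ≠ ⊤ := measure_ball_lt_top.ne
  have hT : Measurable fun x => dyadicTrunc k (u x) := (continuous_dyadicTrunc k).measurable.comp hu
  have hpt : ∀ x ∈ A, ENNReal.ofReal ((2 ^ k / 2) ^ p) * m ≤
      ∫⁻ h in ball (0 : E) r, ‖dyadicTrunc k (u (x + h)) - dyadicTrunc k (u x)‖ₑ ^ p ∂μ := by
    intro x hx
    have hTx := dyadicTrunc_of_le (hAu x hx)
    have hmeas : Measurable fun h => ‖dyadicTrunc k (u (x + h)) - dyadicTrunc k (u x)‖ₑ := by
      have := hT.comp (measurable_const_add x)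
      exact (this.sub_const _).enorm
    set I := ∫⁻ h in ball (0 : E) r, ‖dyadicTrunc k (u (x + h)) - dyadicTrunc k (u x)‖ₑ ∂μ with hI
    have h1 : ENNReal.ofReal (2 ^ k) * m ≤ I + ENNReal.ofReal (2 ^ k / 2) * m := by
      calc ENNReal.ofReal (2 ^ k) * m = ∫⁻ h in ball (0 : E) r, ENNReal.ofReal (2 ^ k) ∂μ := by
            rw [setLIntegral_const]
        _ ≤ ∫⁻ h in ball (0 : E) r,
              (‖dyadicTrunc k (u (x + h)) - dyadicTrunc k (u x)‖ₑ + ‖u (x + h)‖ₑ) ∂μ := by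
            refine lintegral_mono fun h => ?_
            have e1 : ENNReal.ofReal (2 ^ k) = ‖dyadicTrunc k (u x)‖ₑ := by
              rw [hTx, Real.enorm_of_nonneg hk.le]
            have e2 : ‖dyadicTrunc k (u (x + h))‖ₑ ≤ ‖u (x + h)‖ₑ := by
              rw [Real.enorm_of_nonneg (dyadicTrunc_nonneg _ _), Real.enorm_of_nonneg (hu0 _)]
              exact ENNReal.ofReal_le_ofReal (dyadicTrunc_le k (hu0 _))
            calc ENNReal.ofReal (2 ^ k) = ‖dyadicTrunc k (u x)‖ₑ := e1
              _ = ‖dyadicTrunc k (u (x + h)) -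
                    (dyadicTrunc k (u (x + h)) - dyadicTrunc k (u x))‖ₑ := by rw [sub_sub_cancel]
              _ ≤ ‖dyadicTrunc k (u (x + h))‖ₑ + _ := enorm_sub_le
              _ ≤ ‖u (x + h)‖ₑ + _ := by gcongr
              _ = _ := add_comm _ _
        _ = I + ∫⁻ y in ball x r, ‖u y‖ₑ ∂μ := by
            rw [lintegral_add_left hmeas, setLIntegral_ball_translate μ (fun y => ‖u y‖ₑ)]
        _ ≤ _ := by gcongr; exact hav x hx
    have h2 : ENNReal.ofReal (2 ^ k / 2) * m ≤ I := by
      have : ENNReal.ofReal (2 ^ k) = ENNReal.ofReal (2 ^ k / 2) + ENNReal.ofReal (2 ^ k / 2) := by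
        rw [← ENNReal.ofReal_add (by positivity) (by positivity), add_halves]
      rw [this, add_mul] at h1
      exact (ENNReal.add_le_add_iff_right (ENNReal.mul_ne_top ENNReal.ofReal_ne_top hmt)).1 h1
    have h3 := rpow_lintegral_le (ν := μ.restrict (ball 0 r)) hp hmeas.aemeasurable
    rw [Measure.restrict_apply_univ, ← hm] at h3
    have h4 := (ENNReal.rpow_le_rpow h2 (by linarith : 0 ≤ p)).trans h3
    rw [ENNReal.mul_rpow_of_nonneg _ _ (by linarith : 0 ≤ p),
      ENNReal.ofReal_rpow_of_pos (by positivity)] at h4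
    have h5 : m ^ p = m ^ (p - 1) * m := by
      conv_rhs => rw [← ENNReal.rpow_one m, ← ENNReal.rpow_mul, one_mul]
      rw [← ENNReal.rpow_add _ _ hm0 hmt, sub_add_cancel]
    have h6 : m ^ (p - 1) ≠ 0 := (ENNReal.rpow_pos (pos_iff_ne_zero.2 hm0) hmt).ne'
    have h7 : m ^ (p - 1) ≠ ⊤ := ENNReal.rpow_ne_top_of_nonneg (by linarith) hmt
    rw [h5, mul_left_comm] at h4
    exact (ENNReal.mul_le_mul_iff_right h6 h7).1 h4
  calc ENNReal.ofReal ((2 ^ k / 2) ^ p) * m * μ A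
      = ∫⁻ x in A, ENNReal.ofReal ((2 ^ k / 2) ^ p) * m ∂μ := by rw [setLIntegral_const]
    _ ≤ ∫⁻ x in A, ∫⁻ h in ball (0 : E) r,
          ‖dyadicTrunc k (u (x + h)) - dyadicTrunc k (u x)‖ₑ ^ p ∂μ ∂μ :=
        setLIntegral_mono' hA hpt
    _ ≤ ∫⁻ x, ∫⁻ h in ball (0 : E) r,
          ‖dyadicTrunc k (u (x + h)) - dyadicTrunc k (u x)‖ₑ ^ p ∂μ ∂μ :=
        setLIntegral_le_lintegral _ _
    _ = _ := by
        unfold translateDist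
        rw [lintegral_lintegral_swap]
        have := hT.comp (measurable_fst.add measurable_snd : Measurable fun z : E × E => z.1 + z.2)
        exact (((this.sub (hT.comp measurable_fst)).enorm).pow_const p).aemeasurable

theorem measureReal_unitBall_pos {E : Type*} [NormedAddCommGroup E] [NormedSpace ℝ E]
    [FiniteDimensional ℝ E] [MeasurableSpace E] {μ : Measure E} [μ.IsAddHaarMeasure] :
    0 < μ.real (ball (0 : E) 1) :=
  ENNReal.toReal_pos (measure_ball_pos μ _ one_pos).ne' measure_ball_lt_top.ne

variable {μ} in
theorem measure_ball_eq_ofReal (x : E) {r : ℝ} (hr : 0 < r) :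
    μ (ball x r) = ENNReal.ofReal (r ^ finrank ℝ E * μ.real (ball (0 : E) 1)) := by
  rw [ENNReal.ofReal_mul (by positivity), Measure.addHaar_ball_of_pos μ _ hr, measureReal_def,
    ENNReal.ofReal_toReal measure_ball_lt_top.ne]

/-- The superlevel estimate at level `2 ^ (k + 1)` coming from dyadic smoothness at scale `r`. -/
theorem measure_le_of_small_average {s p : ℝ} (hp : 1 ≤ p) {u : E → ℝ} (hu : Measurable u)
    (hu0 : ∀ x, 0 ≤ u x) {k : ℤ} {r : ℝ} (hr : 0 < r) {a : ℝ≥0∞}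
    (ha : ∫⁻ h in ball (0 : E) r, translateDist μ p (fun x => dyadicTrunc k (u x)) h ∂μ ≤
      ENNReal.ofReal (r ^ (finrank ℝ E + s * p)) * a)
    {A : Set E} (hA : MeasurableSet A) (hAu : ∀ x ∈ A, 2 ^ (k + 1) ≤ u x)
    (hav : ∀ x ∈ A, ∫⁻ y in ball x r, ‖u y‖ₑ ∂μ ≤
      ENNReal.ofReal (2 ^ k / 2 * (r ^ finrank ℝ E * μ.real (ball 0 1)))) :
    μ A ≤ ENNReal.ofReal ((2 ^ k / 2) ^ (-p) * (μ.real (ball (0 : E) 1))⁻¹ * r ^ (s * p)) * a := by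
  have hk : (0 : ℝ) < 2 ^ k / 2 := by positivity
  have hv := measureReal_unitBall_pos (μ := μ)
  have hball := measure_ball_eq_ofReal (μ := μ) 0 hr
  have h := (mul_measure_le_of_small_average hp hu hu0 hr hA hAu (fun x hx => by
    rw [hball, ← ENNReal.ofReal_mul hk.le]; exact hav x hx)).trans ha
  rw [hball, ← ENNReal.ofReal_mul (by positivity)] at h
  set c := (2 ^ k / 2) ^ p * (r ^ finrank ℝ E * μ.real (ball (0 : E) 1)) with hc
  have hc0 : 0 < c := by positivity
  calc μ A = ENNReal.ofReal c⁻¹ * (ENNReal.ofReal c * μ A) := by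
        rw [← mul_assoc, ← ENNReal.ofReal_mul (by positivity), inv_mul_cancel₀ hc0.ne']; simp
    _ ≤ ENNReal.ofReal c⁻¹ * (ENNReal.ofReal (r ^ (finrank ℝ E + s * p)) * a) := by gcongr
    _ = _ := by
        rw [← mul_assoc, ← ENNReal.ofReal_mul (by positivity), hc, Real.rpow_add hr,
          Real.rpow_natCast, Real.rpow_neg hk.le]
        congr 2
        field_simp

end Level

/-! ### Two bounds for ball averages and their weighted geometric mean. -/

section Core

open Module Metric

theorem lintegral_le_of_rpow_lintegral_le {X : Type*} [MeasurableSpace X] {ν : Measure X}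
    {w : X → ℝ≥0∞} (hw : AEMeasurable w ν) {m c p : ℝ} (hm : 0 < m) (hc : 0 ≤ c) (hp : 1 ≤ p)
    (hν : ν Set.univ = ENNReal.ofReal m) (h : ∫⁻ x, w x ^ p ∂ν ≤ ENNReal.ofReal c) :
    ∫⁻ x, w x ∂ν ≤ ENNReal.ofReal (m * (m⁻¹ * c) ^ (1 / p)) := by
  have hp0 : 0 < p := by linarith
  rw [← ENNReal.rpow_le_rpow_iff hp0, ENNReal.ofReal_rpow_of_nonneg (by positivity) hp0.le]
  refine (rpow_lintegral_le hp hw).trans ?_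
  rw [hν, ENNReal.ofReal_rpow_of_pos hm]
  refine (mul_le_mul_right h _).trans ?_
  rw [← ENNReal.ofReal_mul (by positivity)]
  refine ENNReal.ofReal_le_ofReal (le_of_eq ?_)
  rw [Real.mul_rpow hm.le (by positivity), ← Real.rpow_mul (by positivity),
    one_div_mul_cancel hp0.ne', Real.rpow_one, Real.rpow_sub_one hm.ne']
  ring

variable {E : Type*} [NormedAddCommGroup E] [NormedSpace ℝ E] [FiniteDimensional ℝ E]
  [MeasurableSpace E] [BorelSpace E] {μ : Measure E} [μ.IsAddHaarMeasure]

/-- The density bounds the square of the mass of `f ≥ |u|^q` on the ball, and Jensen passes from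
`|u|^q` back to `u`; hence the exponent `1 / (2q)`. -/
theorem setLIntegral_ball_le_of_energyDensity_le {q b : ℝ} (hq : 1 ≤ q) (hb : 0 ≤ b) {u : E → ℝ}
    (hu : Measurable u) {f : E → ℝ≥0∞} (hf : Measurable f) (huf : ∀ x, ‖u x‖ₑ ^ q ≤ f x)
    {x : E} {r η m : ℝ} (hr : 0 < r) (hη : 0 ≤ η)
    (hm : m = r ^ finrank ℝ E * μ.real (ball (0 : E) 1))
    (hH : ballEnergyDensity μ b f x ≤ ENNReal.ofReal η) :
    ∫⁻ y in ball x r, ‖u y‖ₑ ∂μ ≤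
      ENNReal.ofReal (m * (m ^ (-2 : ℝ) * r ^ b * η) ^ (1 / (2 * q))) := by
  have hv := measureReal_unitBall_pos (μ := μ)
  have hm0 : 0 < m := by rw [hm]; positivity
  have h1 : ∫⁻ y in ball x r, f y ∂μ ≤ ENNReal.ofReal ((r ^ b * η) ^ (1 / 2 : ℝ)) := by
    rw [← ENNReal.rpow_le_rpow_iff two_pos,
      ENNReal.ofReal_rpow_of_nonneg (by positivity) two_pos.le,
      ← Real.rpow_mul (by positivity)]
    norm_num
    refine ((ENNReal.rpow_two _).symm.le.trans (sq_setLIntegral_ball_le μ hb hf x hr)).trans ?_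
    rw [ENNReal.ofReal_mul (by positivity), ENNReal.ofReal_rpow_of_pos hr]
    gcongr
  refine (lintegral_le_of_rpow_lintegral_le (p := q) hu.enorm.aemeasurable hm0
    (c := (r ^ b * η) ^ (1 / 2 : ℝ)) (by positivity) hq
    (by rw [Measure.restrict_apply_univ, measure_ball_eq_ofReal x hr, hm])
    ((lintegral_mono fun y => huf y).trans h1)).trans ?_
  refine ENNReal.ofReal_le_ofReal (le_of_eq ?_)
  congr 1
  have : m⁻¹ = (m ^ (-2 : ℝ)) ^ (1 / 2 : ℝ) := by
    rw [← Real.rpow_mul hm0.le, ← Real.rpow_neg_one]; norm_num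
  rw [this, ← Real.mul_rpow (by positivity) (by positivity), ← Real.rpow_mul (by positivity)]
  congr 1
  · ring
  · field_simp

theorem setLIntegral_ball_le_of_lintegral_le {γ : ℝ} (hγ : 1 ≤ γ) {u : E → ℝ}
    (hu : Measurable u) {x : E} {r ν m : ℝ} (hr : 0 < r) (hν : 0 ≤ ν)
    (hm : m = r ^ finrank ℝ E * μ.real (ball (0 : E) 1))
    (hu' : ∫⁻ x, ‖u x‖ₑ ^ γ ∂μ ≤ ENNReal.ofReal ν) :
    ∫⁻ y in ball x r, ‖u y‖ₑ ∂μ ≤ ENNReal.ofReal (m * (m⁻¹ * ν) ^ (1 / γ)) := by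
  have hv := measureReal_unitBall_pos (μ := μ)
  exact lintegral_le_of_rpow_lintegral_le hu.enorm.aemeasurable (by rw [hm]; positivity) hν hγ
    (by rw [Measure.restrict_apply_univ, measure_ball_eq_ofReal x hr, hm])
    ((setLIntegral_le_lintegral _ _).trans hu')

/-- If the weighted geometric mean of the two bounds on the average of `u` over `ball x r` is
at most `c`, then so is the average. -/
theorem setLIntegral_ball_le_of_mul_le {q b γ τ n : ℝ} (hq : 1 ≤ q) (hb : 0 ≤ b) (hγ : 1 ≤ γ)
    (hτ : 0 < τ) (hn : 0 ≤ n) {u : E → ℝ}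
    (hu : Measurable u) {f : E → ℝ≥0∞} (hf : Measurable f) (huf : ∀ x, ‖u x‖ₑ ^ q ≤ f x)
    {x : E} {r η ν c : ℝ} (hr : 0 < r) (hη : 0 ≤ η) (hν : 0 ≤ ν) (hc : 0 < c)
    (hH : ballEnergyDensity μ b f x ≤ ENNReal.ofReal η)
    (hu' : ∫⁻ x, ‖u x‖ₑ ^ γ ∂μ ≤ ENNReal.ofReal ν)
    (h : μ.real (ball (0 : E) 1) ^ (-2 * τ - n / γ) *
      r ^ (-((2 * finrank ℝ E - b) * τ + finrank ℝ E * n / γ)) * η ^ τ * ν ^ (n / γ) ≤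
        c ^ (2 * q * τ + n)) :
    ∫⁻ y in ball x r, ‖u y‖ₑ ∂μ ≤
      ENNReal.ofReal (c * (r ^ finrank ℝ E * μ.real (ball (0 : E) 1))) := by
  have hv := measureReal_unitBall_pos (μ := μ)
  set v := μ.real (ball (0 : E) 1)
  set m := r ^ finrank ℝ E * v with hm
  have hm0 : 0 < m := by positivity
  set A := (m ^ (-2 : ℝ) * r ^ b * η) ^ (1 / (2 * q)) with hA
  set B := (m⁻¹ * ν) ^ (1 / γ) with hB
  have hq0 : 0 < q := by linarith
  have hγ0 : 0 < γ := by linarith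
  -- If both bounds exceeded `c`, then the product `A ^ (2qτ) * B ^ n` would exceed `c ^ (2qτ + n)`,
  -- against the hypothesis. Strictness comes from the first factor alone, since `n` may be zero.
  have hAB : A ≤ c ∨ B ≤ c := by
    by_contra! hcon
    have h1 : c ^ (2 * q * τ) < A ^ (2 * q * τ) := Real.rpow_lt_rpow hc.le hcon.1 (by positivity)
    have h2 : c ^ n ≤ B ^ n := Real.rpow_le_rpow hc.le hcon.2.le hn
    have h3 : A ^ (2 * q * τ) = v ^ (-2 * τ) * r ^ (-((2 * finrank ℝ E - b) * τ)) * η ^ τ := by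
      rw [hA, ← Real.rpow_mul (by positivity)]
      have e : 1 / (2 * q) * (2 * q * τ) = τ := by field_simp
      rw [e, Real.mul_rpow (by positivity) hη, Real.mul_rpow (by positivity) (by positivity), hm,
        Real.mul_rpow (by positivity) hv.le, Real.mul_rpow (by positivity) (by positivity),
        ← Real.rpow_natCast, ← Real.rpow_mul hr.le, ← Real.rpow_mul hr.le, ← Real.rpow_mul hr.le,
        ← Real.rpow_mul hv.le, mul_right_comm _ _ (r ^ (b * τ)), ← Real.rpow_add hr]
      rw [mul_comm (r ^ _)]
      congr 3
      ring
    have h4 : B ^ n = v ^ (- (n / γ)) * r ^ (-(finrank ℝ E * n / γ)) * ν ^ (n / γ) := by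
      rw [hB, ← Real.rpow_mul (by positivity), one_div_mul_eq_div,
        Real.mul_rpow (by positivity) hν, hm, mul_inv,
        Real.mul_rpow (by positivity) (by positivity),
        ← Real.rpow_neg_one, ← Real.rpow_neg_one, ← Real.rpow_natCast, ← Real.rpow_mul hr.le,
        ← Real.rpow_mul hr.le, ← Real.rpow_mul hv.le, mul_comm (r ^ _)]
      congr 3 <;> ring
    have h5 : c ^ (2 * q * τ) * c ^ n < A ^ (2 * q * τ) * B ^ n :=
      mul_lt_mul h1 h2 (by positivity) (by positivity)
    rw [← Real.rpow_add hc, h3, h4] at h5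
    refine absurd (h5.trans_le' h) (not_lt.2 (le_of_eq ?_))
    rw [sub_eq_add_neg (-2 * τ), Real.rpow_add hv, neg_add, Real.rpow_add hr]
    ring
  rcases hAB with h1 | h1
  · refine (setLIntegral_ball_le_of_energyDensity_le hq hb hu hf huf hr hη hm hH).trans ?_
    refine ENNReal.ofReal_le_ofReal ?_
    rw [mul_comm]
    gcongr
  · refine (setLIntegral_ball_le_of_lintegral_le hγ hu hr hν hm hu').trans ?_
    refine ENNReal.ofReal_le_ofReal ?_
    rw [mul_comm]
    gcongr

end Core

/-! ### Splitting by the size of the density, and summation over the good levels. -/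

section CoulombSobolevCore

open Module Metric

variable {E : Type*} [NormedAddCommGroup E] [NormedSpace ℝ E] [FiniteDimensional ℝ E]
  [MeasurableSpace E] [BorelSpace E] {μ : Measure E} [μ.IsAddHaarMeasure]

/-- The set where `u` has size about `2 ^ (k + 1)` and `H` is small compared to `u ^ γ`. -/
def goodLevelSet {E : Type*} (γ Λ : ℝ) (H : E → ℝ≥0∞) (u : E → ℝ) (k : ℤ) : Set E :=
  {x | 2 ^ (k + 1) ≤ u x ∧ u x < 2 ^ (k + 2) ∧ H x < ENNReal.ofReal (Λ * u x ^ γ)}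

theorem measurableSet_goodLevelSet {E : Type*} [MeasurableSpace E] {γ Λ : ℝ} {H : E → ℝ≥0∞}
    {u : E → ℝ}     (hH : Measurable H) (hu : Measurable u) (k : ℤ) :
    MeasurableSet (goodLevelSet γ Λ H u k) :=
  ((measurableSet_le measurable_const hu).inter ((measurableSet_lt hu measurable_const).inter
    (measurableSet_lt hH ((hu.pow_const γ).const_mul Λ).ennreal_ofReal)))

/-- Where `H ≥ Λ u ^ γ` the integrand is at most `Λ⁻¹ H`. The remaining points have `u > 0`, so they
lie in some good level set, on which `u < 4 * 2 ^ k`. -/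
theorem lintegral_rpow_le_add_tsum {E : Type*} [MeasurableSpace E] {μ : Measure E} {γ Λ : ℝ}
    (hγ : 0 < γ) (hΛ : 0 < Λ) {H : E → ℝ≥0∞}
    {u : E → ℝ} (hH : Measurable H) (hu : Measurable u) (hu0 : ∀ x, 0 ≤ u x) :
    ∫⁻ x, ‖u x‖ₑ ^ γ ∂μ ≤ ENNReal.ofReal Λ⁻¹ * ∫⁻ x, H x ∂μ +
      ∑' k, ENNReal.ofReal ((4 * 2 ^ k) ^ γ) * μ (goodLevelSet γ Λ H u k) := by
  set B := {x | ENNReal.ofReal (Λ * u x ^ γ) ≤ H x} with hB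
  have hBm : MeasurableSet B :=
    measurableSet_le ((hu.pow_const γ).const_mul Λ).ennreal_ofReal hH
  have hun : ∀ x, ‖u x‖ₑ ^ γ = ENNReal.ofReal (u x ^ γ) := fun x => by
    rw [Real.enorm_of_nonneg (hu0 x), ENNReal.ofReal_rpow_of_nonneg (hu0 x) hγ.le]
  rw [← lintegral_add_compl _ hBm]
  gcongr
  · calc ∫⁻ x in B, ‖u x‖ₑ ^ γ ∂μ ≤ ∫⁻ x in B, ENNReal.ofReal Λ⁻¹ * H x ∂μ := by
          refine setLIntegral_mono' hBm fun x hx => ?_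
          calc ‖u x‖ₑ ^ γ = ENNReal.ofReal Λ⁻¹ * ENNReal.ofReal (Λ * u x ^ γ) := by
                rw [hun, ← ENNReal.ofReal_mul (by positivity), inv_mul_cancel_left₀ hΛ.ne']
            _ ≤ _ := mul_le_mul_right hx _
      _ ≤ ∫⁻ x, ENNReal.ofReal Λ⁻¹ * H x ∂μ := setLIntegral_le_lintegral _ _
      _ = _ := lintegral_const_mul _ hH
  · have hsub : Bᶜ ⊆ ⋃ k, goodLevelSet γ Λ H u k := by
      intro x hx
      have hx' : H x < ENNReal.ofReal (Λ * u x ^ γ) := not_le.1 hx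
      have hux : 0 < u x := by
        rcases (hu0 x).eq_or_lt with h | h
        · rw [← h, Real.zero_rpow hγ.ne'] at hx'
          simp at hx'
        · exact h
      obtain ⟨j, hj1, hj2⟩ := exists_mem_Ico_zpow hux (one_lt_two (α := ℝ))
      refine Set.mem_iUnion.2 ⟨j - 1, ?_, ?_, hx'⟩
      · rwa [sub_add_cancel]
      · rw [show j - 1 + 2 = j + 1 by ring]
        exact hj2
    calc ∫⁻ x in Bᶜ, ‖u x‖ₑ ^ γ ∂μ ≤ ∫⁻ x in ⋃ k, goodLevelSet γ Λ H u k, ‖u x‖ₑ ^ γ ∂μ :=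
          lintegral_mono_set hsub
      _ ≤ ∑' k, ∫⁻ x in goodLevelSet γ Λ H u k, ‖u x‖ₑ ^ γ ∂μ := lintegral_iUnion_le _ _
      _ ≤ _ := by
          refine ENNReal.tsum_le_tsum fun k => ?_
          rw [← setLIntegral_const]
          refine setLIntegral_mono' (measurableSet_goodLevelSet hH hu k) fun x hx => ?_
          rw [hun]
          refine ENNReal.ofReal_le_ofReal (Real.rpow_le_rpow (hu0 x) ?_ hγ.le)
          have h2 := hx.2.1.le
          rw [zpow_add₀ two_ne_zero] at h2
          linarith

/-- Rounding `y ^ (1/σ)` up to a power of two at most doubles it. The smoothness hypothesis is only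
available at dyadic radii. -/
theorem exists_zpow_two_rpow_bounds {y σ : ℝ} (hy : 0 < y) (hσ : 0 < σ) :
    ∃ j : ℤ, y ≤ ((2 : ℝ) ^ j) ^ σ ∧ ((2 : ℝ) ^ j) ^ σ ≤ 2 ^ σ * y := by
  have hR : 0 < y ^ (1 / σ) := by positivity
  have hRσ : (y ^ (1 / σ)) ^ σ = y := by
    rw [← Real.rpow_mul hy.le, one_div_mul_cancel hσ.ne', Real.rpow_one]
  obtain ⟨j, hj1, hj2⟩ := exists_mem_Ioc_zpow hR (one_lt_two (α := ℝ))
  refine ⟨j + 1, ?_, ?_⟩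
  · calc y = (y ^ (1 / σ)) ^ σ := hRσ.symm
      _ ≤ _ := Real.rpow_le_rpow hR.le hj2 hσ.le
  · calc ((2 : ℝ) ^ (j + 1)) ^ σ ≤ (2 * y ^ (1 / σ)) ^ σ := by
          refine Real.rpow_le_rpow (by positivity) ?_ hσ.le
          rw [two_zpow_succ]; linarith
      _ = _ := by rw [Real.mul_rpow two_pos.le hR.le, hRσ]

/-- Summed superlevel estimates on the good level sets. -/
theorem tsum_goodLevelSet_le {s p q b γ τ n : ℝ} (hp : 1 ≤ p) (hq : 1 ≤ q) (hb : 0 ≤ b)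
    (hγ : 1 ≤ γ) (hτ : 0 < τ) (hn : 0 ≤ n) (hsp : 0 < s * p)
    (hscal : (2 * finrank ℝ E - b) * τ + finrank ℝ E * n / γ = s * p)
    (hexp : 2 * q * τ + n = γ + γ * τ - p)
    {u : E → ℝ} (hu : Measurable u) (hu0 : ∀ x, 0 ≤ u x)
    {f : E → ℝ≥0∞} (hf : Measurable f) (huf : ∀ x, ‖u x‖ₑ ^ q ≤ f x)
    {ν : ℝ} (hν : 0 < ν) (hu' : ∫⁻ x, ‖u x‖ₑ ^ γ ∂μ ≤ ENNReal.ofReal ν)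
    {N : ℝ≥0∞} (hN : HasDyadicSmoothness μ s p u N) {Λ : ℝ} (hΛ : 0 < Λ) :
    ∑' k, ENNReal.ofReal ((4 * 2 ^ k) ^ γ) * μ (goodLevelSet γ Λ (ballEnergyDensity μ b f) u k) ≤
      ENNReal.ofReal (4 ^ γ * 2 ^ p * (μ.real (ball (0 : E) 1))⁻¹ * 2 ^ (s * p) *
        (μ.real (ball (0 : E) 1) ^ (-2 * τ - n / γ) * 4 ^ (γ * τ) * 2 ^ (2 * q * τ + n)) *
          (Λ ^ τ * ν ^ (n / γ))) * N := by
  set v := μ.real (ball (0 : E) 1) with hvdef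
  have hv : 0 < v := measureReal_unitBall_pos (μ := μ)
  set H := ballEnergyDensity μ b f
  have hHm : Measurable H := measurable_ballEnergyDensity μ b hf
  set c₁ := v ^ (-2 * τ - n / γ) * 4 ^ (γ * τ) * 2 ^ (2 * q * τ + n) with hc₁
  have hc₁0 : 0 < c₁ := by positivity
  set Q := c₁ * (Λ ^ τ * ν ^ (n / γ)) with hQ
  have hQ0 : 0 < Q := by positivity
  -- The radius `2 ^ j` is, up to a factor two, the least one at which the geometric mean forces
  -- averages down to `2 ^ k / 2`. With it `(2 ^ k) ^ (γ - p) * r ^ (s * p)` is at most a constant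
  -- times `Q`, independently of `k`.
  have hj : ∀ k : ℤ, ∃ j : ℤ, Q * ((2 : ℝ) ^ k) ^ (p - γ) ≤ ((2 : ℝ) ^ j) ^ (s * p) ∧
      ((2 : ℝ) ^ j) ^ (s * p) ≤ 2 ^ (s * p) * (Q * ((2 : ℝ) ^ k) ^ (p - γ)) := fun k =>
    exists_zpow_two_rpow_bounds (by positivity) hsp
  choose j hj1 hj2 using hj
  -- A finite partial sum involves finitely many radii, hence a smallest exponent `J`. The constants
  -- `a` may depend on `J`; only the bound `N` on their sum must not.
  rw [ENNReal.tsum_eq_iSup_sum]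
  refine iSup_le fun F => ?_
  obtain ⟨J, hJ⟩ := (F.image j).bddBelow
  obtain ⟨a, haN, ha⟩ := hN J
  have hlevel : ∀ k ∈ F, ENNReal.ofReal ((4 * 2 ^ k) ^ γ) * μ (goodLevelSet γ Λ H u k) ≤
      ENNReal.ofReal (4 ^ γ * 2 ^ p * v⁻¹ * 2 ^ (s * p) * c₁ * (Λ ^ τ * ν ^ (n / γ))) * a k := by
    intro k hk
    have ht : (0 : ℝ) < 2 ^ k := by positivity
    have hr : (0 : ℝ) < 2 ^ j k := by positivity
    have hmeas := measure_le_of_small_average μ hp hu hu0 hr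
      (ha k (j k) (hJ (Finset.mem_coe.2 (Finset.mem_image_of_mem j hk))))
      (measurableSet_goodLevelSet (γ := γ) (Λ := Λ) hHm hu k) (fun x hx => hx.1) (fun x hx => by
        refine setLIntegral_ball_le_of_mul_le (η := Λ * (4 * 2 ^ k) ^ γ) hq hb hγ hτ hn hu hf huf hr
          (by positivity) hν.le (by positivity) ?_ hu' ?_
        · refine hx.2.2.le.trans (ENNReal.ofReal_le_ofReal ?_)
          have h2 := hx.2.1.le
          rw [zpow_add₀ two_ne_zero] at h2
          have := hu0 x
          gcongr
          linarith
        · rw [hscal, ← hvdef, Real.mul_rpow hΛ.le (by positivity), ← Real.rpow_mul (by positivity),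
            Real.mul_rpow (by norm_num) ht.le, Real.div_rpow ht.le two_pos.le, Real.rpow_neg hr.le,
            le_div_iff₀ (by positivity), ← div_eq_mul_inv, div_mul_eq_mul_div, div_mul_eq_mul_div,
            div_mul_eq_mul_div, div_le_iff₀ (by positivity)]
          calc _ = Q * (2 ^ k) ^ (γ * τ) := by rw [hQ, hc₁]; ring
            _ = (2 ^ k) ^ (2 * q * τ + n) * (Q * (2 ^ k) ^ (p - γ)) := by
              rw [mul_left_comm, ← Real.rpow_add ht, hexp]
              congr 2; ring
            _ ≤ _ := by gcongr; exact hj1 k)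
    refine (mul_le_mul_right hmeas _).trans ?_
    rw [← mul_assoc, ← ENNReal.ofReal_mul (by positivity)]
    refine mul_le_mul_left (ENNReal.ofReal_le_ofReal ?_) _
    rw [← hvdef]
    calc (4 * 2 ^ k) ^ γ * ((2 ^ k / 2) ^ (-p) * v⁻¹ * ((2 : ℝ) ^ j k) ^ (s * p))
        ≤ (4 * 2 ^ k) ^ γ * ((2 ^ k / 2) ^ (-p) * v⁻¹ *
            (2 ^ (s * p) * (Q * ((2 : ℝ) ^ k) ^ (p - γ)))) := by gcongr; exact hj2 k
      _ = 4 ^ γ * 2 ^ p * v⁻¹ * 2 ^ (s * p) * Q *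
            (((2 : ℝ) ^ k) ^ γ * ((2 : ℝ) ^ k) ^ (-p) * ((2 : ℝ) ^ k) ^ (p - γ)) := by
          rw [Real.mul_rpow (by norm_num) ht.le, Real.div_rpow ht.le two_pos.le,
            Real.rpow_neg two_pos.le]
          field_simp
      _ = _ := by
          rw [← Real.rpow_add ht, ← Real.rpow_add ht]
          have : γ + -p + (p - γ) = 0 := by ring
          rw [this, Real.rpow_zero, hQ]
          ring
  calc _ ≤ ∑ k ∈ F, ENNReal.ofReal (4 ^ γ * 2 ^ p * v⁻¹ * 2 ^ (s * p) * c₁ *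
        (Λ ^ τ * ν ^ (n / γ))) * a k := Finset.sum_le_sum hlevel
    _ ≤ _ := by
        rw [← Finset.mul_sum]
        gcongr
        exact (ENNReal.sum_le_tsum F).trans haN

end CoulombSobolevCore

/-! ### Absorption, degenerate cases, and the inequality under dyadic smoothness. -/

section CoulombSobolevCore

open Module Metric

variable {E : Type*} [NormedAddCommGroup E] [NormedSpace ℝ E] [FiniteDimensional ℝ E]
  [MeasurableSpace E] [BorelSpace E] {μ : Measure E} [μ.IsAddHaarMeasure]

theorem exists_rpow_le_of_hasDyadicSmoothness (μ : Measure E) [μ.IsAddHaarMeasure]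
    {s p q b γ τ n : ℝ} (hp : 1 ≤ p) (hq : 1 ≤ q)
    (hb : 0 ≤ b) (hγ : 1 ≤ γ) (hτ : 0 < τ) (hn : 0 ≤ n) (hsp : 0 < s * p)
    (hscal : (2 * finrank ℝ E - b) * τ + finrank ℝ E * n / γ = s * p)
    (hexp : 2 * q * τ + n = γ + γ * τ - p) :
    ∃ K : ℝ, 0 < K ∧ ∀ (u : E → ℝ) (f : E → ℝ≥0∞), Measurable u → (∀ x, 0 ≤ u x) →
      Measurable f → (∀ x, ‖u x‖ₑ ^ q ≤ f x) → ∀ ν e N : ℝ, 0 < ν → 0 < e → 0 < N →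
      ∫⁻ x, ‖u x‖ₑ ^ γ ∂μ = ENNReal.ofReal ν →
      ∫⁻ x, ballEnergyDensity μ b f x ∂μ ≤ ENNReal.ofReal e →
      HasDyadicSmoothness μ s p u (ENNReal.ofReal N) →
      ν ^ (1 + τ - n / γ) ≤ K * (e ^ τ * N) := by
  have hv : 0 < μ.real (ball (0 : E) 1) := measureReal_unitBall_pos (μ := μ)
  set c : ℝ := 4 ^ γ * 2 ^ p * (μ.real (ball (0 : E) 1))⁻¹ * 2 ^ (s * p) *
        (μ.real (ball (0 : E) 1) ^ (-2 * τ - n / γ) * 4 ^ (γ * τ) * 2 ^ (2 * q * τ + n)) with hc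
  have hc0 : 0 < c := by positivity
  refine ⟨2 * c * 2 ^ τ, by positivity, ?_⟩
  intro u f hu hu0 hf huf ν e N hν he hN hνu hef hNu
  -- With this choice the part with large density contributes at most `Λ⁻¹ * e = ν / 2`, which is
  -- absorbed on the left because `ν` is finite.
  set Λ := 2 * e / ν with hΛdef
  have hΛ : 0 < Λ := by positivity
  have h1 := lintegral_rpow_le_add_tsum (μ := μ) (γ := γ) (by linarith) hΛ
    (measurable_ballEnergyDensity μ b hf) hu hu0
  have h2 := tsum_goodLevelSet_le hp hq hb hγ hτ hn hsp hscal hexp hu hu0 hf huf hν hνu.le hNu hΛ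
  rw [← hc, ← ENNReal.ofReal_mul (by positivity)] at h2
  have h3 : ENNReal.ofReal Λ⁻¹ * ∫⁻ x, ballEnergyDensity μ b f x ∂μ ≤
      ENNReal.ofReal (Λ⁻¹ * e) := by
    rw [ENNReal.ofReal_mul (by positivity)]
    gcongr
  have h4 := h1.trans (add_le_add h3 h2)
  rw [hνu, ← ENNReal.ofReal_add (by positivity) (by positivity),
    ENNReal.ofReal_le_ofReal_iff (by positivity)] at h4
  have h5 : Λ⁻¹ * e = ν / 2 := by rw [hΛdef]; field_simp
  have h6 : ν ≤ 2 * (c * (Λ ^ τ * ν ^ (n / γ)) * N) := by linarith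
  have h7 : Λ ^ τ = 2 ^ τ * e ^ τ / ν ^ τ := by
    rw [hΛdef, Real.div_rpow (by positivity) hν.le, Real.mul_rpow two_pos.le he.le]
  rw [h7] at h6
  rw [Real.rpow_sub hν, Real.rpow_add hν, Real.rpow_one, div_le_iff₀ (by positivity)]
  have h8 : 0 < ν ^ τ := by positivity
  calc ν * ν ^ τ ≤ 2 * (c * (2 ^ τ * e ^ τ / ν ^ τ * ν ^ (n / γ)) * N) * ν ^ τ := by gcongr
    _ = _ := by field_simp

/-- The density vanishes at some point `x`, and there it controls the mass of `f` on every ball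
about `x`. -/
theorem lintegral_eq_zero_of_ballEnergyDensity {b : ℝ} (hb : 0 ≤ b) {f : E → ℝ≥0∞}
    (hf : Measurable f) (h : ∫⁻ x, ballEnergyDensity μ b f x ∂μ = 0) : ∫⁻ x, f x ∂μ = 0 := by
  rw [lintegral_eq_zero_iff (measurable_ballEnergyDensity μ b hf)] at h
  obtain ⟨x, hx⟩ := h.exists
  have hball : ∀ m : ℕ, ∫⁻ y in ball x (m + 1), f y ∂μ = 0 := by
    intro m
    have := sq_setLIntegral_ball_le μ hb hf x (r := m + 1) (by positivity)
    rw [hx, Pi.zero_apply, mul_zero, nonpos_iff_eq_zero, ENNReal.rpow_eq_zero_iff] at this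
    rcases this with h | h
    · exact h.1
    · linarith [h.2]
  have hU : (⋃ m : ℕ, ball x (m + 1 : ℝ)) = Set.univ := by
    refine Set.eq_univ_of_forall fun y => ?_
    obtain ⟨m, hm⟩ := exists_nat_gt (dist y x)
    exact Set.mem_iUnion.2 ⟨m, mem_ball.2 (by linarith)⟩
  rw [← setLIntegral_univ, ← hU]
  refine le_antisymm ((lintegral_iUnion_le _ _).trans ?_) zero_le
  simp [hball]

/-- All layer constants vanish, so a superlevel set is null as soon as averages of `u` are small at
one radius. Large balls provide this, since `u` lies in `L^γ`. This settles the case of zero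
seminorm, which the main estimate excludes. -/
theorem lintegral_rpow_eq_zero_of_hasDyadicSmoothness_zero {s p γ : ℝ}
    (hd : 1 ≤ finrank ℝ E) (hp : 1 ≤ p) (hγ : 1 ≤ γ)
    {u : E → ℝ} (hu : Measurable u) (hu0 : ∀ x, 0 ≤ u x)
    (hut : ∫⁻ x, ‖u x‖ₑ ^ γ ∂μ ≠ ⊤) (h : HasDyadicSmoothness μ s p u 0) :
    ∫⁻ x, ‖u x‖ₑ ^ γ ∂μ = 0 := by
  have hv : 0 < μ.real (ball (0 : E) 1) := measureReal_unitBall_pos (μ := μ)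
  set v := μ.real (ball (0 : E) 1) with hvdef
  set ν := (∫⁻ x, ‖u x‖ₑ ^ γ ∂μ).toReal
  have hνu : ∫⁻ x, ‖u x‖ₑ ^ γ ∂μ = ENNReal.ofReal ν := (ENNReal.ofReal_toReal hut).symm
  have hν : 0 ≤ ν := ENNReal.toReal_nonneg
  have hnull : ∀ k : ℤ, μ {x | 2 ^ (k + 1) ≤ u x} = 0 := by
    intro k
    have hc : (0 : ℝ) < 2 ^ k / 2 := by positivity
    -- As the dimension is at least one, a ball of radius `2 ^ i` has volume at least `2 ^ i * v`,
    -- enough to bring the `L^γ` bound for the average below `2 ^ k / 2`.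
    obtain ⟨i, hi⟩ := pow_unbounded_of_one_lt (ν / (2 ^ k / 2) ^ γ / v) (one_lt_two (α := ℝ))
    obtain ⟨a, ha0, ha⟩ := h i
    have hak : a k = 0 := by
      have := (ENNReal.le_tsum k).trans ha0
      simpa using this
    have hr : (0 : ℝ) < 2 ^ (i : ℤ) := by positivity
    have hle := measure_le_of_small_average μ hp hu hu0 hr (ha k i le_rfl)
      (measurableSet_le measurable_const hu) (A := {x | 2 ^ (k + 1) ≤ u x})
      (fun x hx => hx) (fun x _ => by
        refine (setLIntegral_ball_le_of_lintegral_le hγ hu hr hν rfl hνu.le).trans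
          (ENNReal.ofReal_le_ofReal ?_)
        rw [mul_comm, ← hvdef]
        have hm : 0 < (2 ^ (i : ℤ)) ^ finrank ℝ E * v := by positivity
        refine mul_le_mul_of_nonneg_right ?_ hm.le
        have hX : ((2 ^ (i : ℤ)) ^ finrank ℝ E * v)⁻¹ * ν ≤ (2 ^ k / 2) ^ γ := by
          rw [inv_mul_le_iff₀ hm]
          rw [div_div, div_lt_iff₀ (by positivity)] at hi
          have h1 : (2 : ℝ) ^ i ≤ (2 ^ (i : ℤ)) ^ finrank ℝ E := by
            rw [zpow_natCast]
            exact le_self_pow₀ (one_le_pow₀ one_le_two) (by omega)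
          calc ν ≤ 2 ^ i * ((2 ^ k / 2) ^ γ * v) := hi.le
            _ ≤ (2 ^ (i : ℤ)) ^ finrank ℝ E * ((2 ^ k / 2) ^ γ * v) := by gcongr
            _ = _ := by ring
        calc _ ≤ ((2 ^ k / 2 : ℝ) ^ γ) ^ (1 / γ) :=
              Real.rpow_le_rpow (by positivity) hX (by positivity)
          _ = _ := by
              rw [← Real.rpow_mul hc.le, mul_one_div_cancel (by linarith), Real.rpow_one])
    rw [hak, mul_zero] at hle
    exact le_antisymm hle zero_le
  have hpos : ∀ᵐ x ∂μ, ∀ k : ℤ, ¬ 2 ^ (k + 1) ≤ u x := ae_all_iff.2 fun k => by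
    rw [ae_iff]; simpa using hnull k
  refine lintegral_eq_zero_of_ae_eq_zero ?_
  filter_upwards [hpos] with x hx
  have : u x = 0 := by
    by_contra hne
    obtain ⟨j, hj, -⟩ := exists_mem_Ico_zpow ((hu0 x).lt_of_ne' hne) (one_lt_two (α := ℝ))
    exact hx (j - 1) (by rwa [sub_add_cancel])
  simp [this, show 0 < γ by linarith]

/-- The Coulomb–Sobolev inequality for a nonnegative function in `L^γ`. -/
theorem exists_lintegral_rpow_le {s p q α γ β₁ β₂ : ℝ} (μ : Measure E) [μ.IsAddHaarMeasure]
    (hd : 1 ≤ finrank ℝ E) (hp : 1 ≤ p) (hq : 1 ≤ q) (hγ : 1 ≤ γ) (hα₀ : 0 < α)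
    (hαd : α < finrank ℝ E) (hβ₁ : 0 < β₁) (hβ₂ : 0 < β₂)
    (hscal₁ : β₁ * p + 2 * β₂ * q = 1)
    (hscal₂ : (finrank ℝ E - s * p) * β₁ + (finrank ℝ E + α) * β₂ = finrank ℝ E / γ)
    (hcond : 1 ≤ β₁ * γ + β₂ * γ) :
    ∃ C : ℝ≥0, 0 < C ∧ ∀ (u : E → ℝ) (f : E → ℝ≥0∞) (N : ℝ≥0∞), Measurable u → (∀ x, 0 ≤ u x) →
      Measurable f → (∀ x, ‖u x‖ₑ ^ q ≤ f x) → ∫⁻ x, ‖u x‖ₑ ^ γ ∂μ ≠ ⊤ →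
      HasDyadicSmoothness μ s p u N →
      (∫⁻ x, ‖u x‖ₑ ^ γ ∂μ) ^ (1 / γ) ≤
        C * N ^ β₁ * (∫⁻ x, ∫⁻ y, f x * f y / ‖x - y‖ₑ ^ (finrank ℝ E - α) ∂μ ∂μ) ^ β₂ := by
  have hγ0 : 0 < γ := by linarith
  have hD1 : (1 : ℝ) ≤ finrank ℝ E := by exact_mod_cast hd
  -- The two scaling relations translate into the exponent identities of the main estimate for `τ =
  -- β₂ / β₁`, `n = (γ(β₁ + β₂) - 1) / β₁` and `b = 2d - α`, where `d` is the dimension. The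
  -- condition on `β₁γ + β₂γ` is `n ≥ 0`, and then the first identity forces `s * p > 0`.
  have hscal : (2 * finrank ℝ E - (2 * finrank ℝ E - α)) * (β₂ / β₁) +
      finrank ℝ E * ((γ * (β₁ + β₂) - 1) / β₁) / γ = s * p := by
    have h : (finrank ℝ E : ℝ) =
        ((finrank ℝ E - s * p) * β₁ + (finrank ℝ E + α) * β₂) * γ := by
      rw [hscal₂]; field_simp
    field_simp
    linear_combination -h
  have hexp : 2 * q * (β₂ / β₁) + (γ * (β₁ + β₂) - 1) / β₁ = γ + γ * (β₂ / β₁) - p := by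
    field_simp
    linear_combination hscal₁
  have hn : 0 ≤ (γ * (β₁ + β₂) - 1) / β₁ := div_nonneg (by linarith) hβ₁.le
  have hτ : 0 < β₂ / β₁ := by positivity
  have hsp : 0 < s * p := by
    rw [← hscal]
    have : 0 < (2 * finrank ℝ E - (2 * finrank ℝ E - α)) * (β₂ / β₁) := by
      rw [sub_sub_cancel]; positivity
    positivity
  have hb : (finrank ℝ E : ℝ) < 2 * finrank ℝ E - α := by linarith
  have hb0 : (0 : ℝ) ≤ 2 * finrank ℝ E - α := by linarith
  obtain ⟨K, hK, hmain⟩ :=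
    exists_rpow_le_of_hasDyadicSmoothness μ hp hq hb0 hγ hτ hn hsp hscal hexp
  set c := ∫⁻ x : E, (max ‖x‖ₑ (ENNReal.ofReal (1 / 2))) ^ (-(2 * finrank ℝ E - α)) ∂μ + 1 with hc
  have hct : c ≠ ⊤ :=
    ENNReal.add_ne_top.2 ⟨(lintegral_max_enorm_rpow_lt_top μ hb).ne, ENNReal.one_ne_top⟩
  have hc0 : 0 < c.toReal := ENNReal.toReal_pos (by rw [hc]; simp) hct
  have hCpos : 0 < K ^ β₁ * c.toReal ^ β₂ := by positivity
  refine ⟨(K ^ β₁ * c.toReal ^ β₂).toNNReal, Real.toNNReal_pos.2 hCpos, ?_⟩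
  intro u f N hu hu0 hf huf hut hN
  have hH := lintegral_ballEnergyDensity_le μ hb hf
  rw [show (2 * finrank ℝ E - α - finrank ℝ E : ℝ) = finrank ℝ E - α by ring, ← hc] at hH
  set Q := ∫⁻ x, ∫⁻ y, f x * f y / ‖x - y‖ₑ ^ (finrank ℝ E - α) ∂μ ∂μ
  -- Extended values are settled first. If `N` or `Q` is zero then `u` vanishes almost everywhere;
  -- so once the left side is nonzero no product `0 * ⊤` can occur on the right.
  rcases eq_or_ne (∫⁻ x, ‖u x‖ₑ ^ γ ∂μ) 0 with hν0 | hν0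
  · rw [hν0, ENNReal.zero_rpow_of_pos (by positivity)]
    exact zero_le
  have hN0 : N ≠ 0 := by
    rintro rfl
    exact hν0 (lintegral_rpow_eq_zero_of_hasDyadicSmoothness_zero hd hp hγ hu hu0 hut hN)
  have hQ0 : Q ≠ 0 := by
    intro hQ
    rw [hQ, mul_zero] at hH
    have hf0 := lintegral_eq_zero_of_ballEnergyDensity hb0 hf (le_antisymm hH zero_le)
    rw [lintegral_eq_zero_iff hf] at hf0
    refine hν0 (lintegral_eq_zero_of_ae_eq_zero ?_)
    filter_upwards [hf0] with x hx
    have h := huf x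
    rw [hx, Pi.zero_apply, nonpos_iff_eq_zero, ENNReal.rpow_eq_zero_iff_of_pos (by linarith)] at h
    rw [h, ENNReal.zero_rpow_of_pos hγ0, Pi.zero_apply]
  have hC0 : ((K ^ β₁ * c.toReal ^ β₂).toNNReal : ℝ≥0∞) ≠ 0 := by
    simpa using hCpos
  rcases eq_or_ne N ⊤ with rfl | hNt
  · rw [ENNReal.top_rpow_of_pos hβ₁, ENNReal.mul_top hC0, ENNReal.top_mul]
    · exact le_top
    · rw [Ne, ENNReal.rpow_eq_zero_iff_of_pos hβ₂]; exact hQ0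
  rcases eq_or_ne Q ⊤ with hQt | hQt
  · rw [hQt, ENNReal.top_rpow_of_pos hβ₂, ENNReal.mul_top]
    · exact le_top
    · refine mul_ne_zero hC0 ?_
      rw [Ne, ENNReal.rpow_eq_zero_iff_of_pos hβ₁]; exact hN0
  have hν : 0 < (∫⁻ x, ‖u x‖ₑ ^ γ ∂μ).toReal := ENNReal.toReal_pos hν0 hut
  have hN' : 0 < N.toReal := ENNReal.toReal_pos hN0 hNt
  have hQ' : 0 < Q.toReal := ENNReal.toReal_pos hQ0 hQt
  have h := hmain u f hu hu0 hf huf _ (c.toReal * Q.toReal) N.toReal hν (by positivity) hN'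
    (ENNReal.ofReal_toReal hut).symm
    (by rwa [ENNReal.ofReal_mul hc0.le, ENNReal.ofReal_toReal hct, ENNReal.ofReal_toReal hQt])
    (by rwa [ENNReal.ofReal_toReal hNt])
  rw [← ENNReal.ofReal_toReal hut, ← ENNReal.ofReal_toReal hNt, ← ENNReal.ofReal_toReal hQt,
    ENNReal.ofReal_rpow_of_pos hν, ENNReal.ofReal_rpow_of_pos hN', ENNReal.ofReal_rpow_of_pos hQ']
  change _ ≤ ENNReal.ofReal _ * _ * _
  rw [← ENNReal.ofReal_mul hCpos.le, ← ENNReal.ofReal_mul (by positivity)]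
  refine ENNReal.ofReal_le_ofReal ?_
  have h2 := Real.rpow_le_rpow (by positivity) h hβ₁.le
  rw [← Real.rpow_mul hν.le, Real.mul_rpow hK.le (by positivity),
    Real.mul_rpow (by positivity) hN'.le, ← Real.rpow_mul (by positivity),
    div_mul_cancel₀ _ hβ₁.ne', Real.mul_rpow hc0.le hQ'.le] at h2
  -- Raising the main estimate to the power `β₁` turns the exponent of `ν` into `1 / γ`.
  have e : (1 + β₂ / β₁ - (γ * (β₁ + β₂) - 1) / β₁ / γ) * β₁ = 1 / γ := by
    field_simp
    ring
  rw [e] at h2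
  exact h2.trans (le_of_eq (by ring))

end CoulombSobolevCore

/-! ### Dyadic smoothness from the Gagliardo seminorm and from a first-order translation bound. -/

section Smoothness

open Module Metric

variable {E : Type*} [NormedAddCommGroup E] [NormedSpace ℝ E] [FiniteDimensional ℝ E]
  [MeasurableSpace E] [BorelSpace E] {μ : Measure E} [μ.IsAddHaarMeasure]

theorem tsum_translateDist_dyadicTrunc_le {E : Type*} [NormedAddCommGroup E] [MeasurableSpace E]
    [BorelSpace E] {μ : Measure E} {p : ℝ} (hp : 1 ≤ p) {u g : E → ℝ} (hu : Measurable u)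
    (hug : ∀ x y, ‖u x - u y‖ₑ ≤ ‖g x - g y‖ₑ) (h : E) :
    ∑' k, translateDist μ p (fun x => dyadicTrunc k (u x)) h ≤ translateDist μ p g h := by
  unfold translateDist
  rw [← lintegral_tsum]
  · refine lintegral_mono fun x => (tsum_dyadicTrunc_sub_rpow_le _ _ hp).trans ?_
    exact ENNReal.rpow_le_rpow (hug _ _) (by linarith)
  · intro k
    have hT : Measurable fun x => dyadicTrunc k (u x) :=
      (continuous_dyadicTrunc k).measurable.comp hu
    have := hT.comp (measurable_add_const h)
    exact ((this.sub hT).enorm.pow_const p).aemeasurable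

theorem lintegral_gagliardo_eq (μ : Measure E) [μ.IsAddHaarMeasure] {p c : ℝ} {g : E → ℝ}
    (hg : Measurable g) :
    ∫⁻ x, ∫⁻ y, ‖g x - g y‖ₑ ^ p / ‖x - y‖ₑ ^ c ∂μ ∂μ =
      ∫⁻ h, translateDist μ p g h / ‖h‖ₑ ^ c ∂μ := by
  calc _ = ∫⁻ x, ∫⁻ h, ‖g (x + h) - g x‖ₑ ^ p / ‖h‖ₑ ^ c ∂μ ∂μ := by
        refine lintegral_congr fun x => ?_
        rw [← lintegral_add_left_eq_self (fun y => ‖g x - g y‖ₑ ^ p / ‖x - y‖ₑ ^ c) x]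
        refine lintegral_congr fun h => ?_
        rw [← enorm_neg (g x - _), neg_sub, sub_add_cancel_left, enorm_neg]
    _ = ∫⁻ h, ∫⁻ x, ‖g (x + h) - g x‖ₑ ^ p / ‖h‖ₑ ^ c ∂μ ∂μ :=
        lintegral_lintegral_swap (by fun_prop)
    _ = _ := by
        refine lintegral_congr fun h => ?_
        unfold translateDist
        simp_rw [div_eq_mul_inv]
        rw [lintegral_mul_const]
        fun_prop

/-- The constant of level `k` is the Gagliardo energy of that layer, whatever `J` is. On the ball of
radius `2 ^ j` the weight `|h| ^ c` is at most `(2 ^ j) ^ c`. -/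
theorem hasDyadicSmoothness_of_gagliardo {s p : ℝ} (hs : 0 ≤ s) (hp : 1 ≤ p) {u g : E → ℝ}
    (hu : Measurable u) (hg : Measurable g) (hug : ∀ x y, ‖u x - u y‖ₑ ≤ ‖g x - g y‖ₑ) :
    HasDyadicSmoothness μ s p u
      (∫⁻ x, ∫⁻ y, ‖g x - g y‖ₑ ^ p / ‖x - y‖ₑ ^ (finrank ℝ E + s * p) ∂μ ∂μ) := by
  have hc : 0 ≤ finrank ℝ E + s * p := by positivity
  set c := finrank ℝ E + s * p
  intro J
  have hT : ∀ k, Measurable fun x => dyadicTrunc k (u x) := fun k =>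
    (continuous_dyadicTrunc k).measurable.comp hu
  refine ⟨fun k => ∫⁻ h, translateDist μ p (fun x => dyadicTrunc k (u x)) h / ‖h‖ₑ ^ c ∂μ, ?_, ?_⟩
  · rw [← lintegral_tsum]
    · calc _ = ∫⁻ h, (∑' k, translateDist μ p (fun x => dyadicTrunc k (u x)) h) / ‖h‖ₑ ^ c ∂μ := by
            simp_rw [div_eq_mul_inv, ENNReal.tsum_mul_right]
        _ ≤ ∫⁻ h, translateDist μ p g h / ‖h‖ₑ ^ c ∂μ :=
            lintegral_mono fun h =>
              ENNReal.div_le_div_right (tsum_translateDist_dyadicTrunc_le hp hu hug h) _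
        _ = _ := (lintegral_gagliardo_eq μ hg).symm
    · intro k
      exact ((measurable_translateDist μ p (hT k)).div (by fun_prop)).aemeasurable
  · intro k j _
    have hr : (0 : ℝ) < 2 ^ j := by positivity
    rw [← ENNReal.ofReal_rpow_of_pos hr, ← lintegral_const_mul' _ _
      (ENNReal.rpow_ne_top_of_nonneg hc ENNReal.ofReal_ne_top)]
    refine (setLIntegral_mono' measurableSet_ball fun h hh => ?_).trans
      (setLIntegral_le_lintegral _ _)
    rcases eq_or_ne h 0 with rfl | h0
    · have : translateDist μ p (fun x => dyadicTrunc k (u x)) 0 = 0 := by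
        simp [translateDist, show 0 < p by linarith]
      rw [this]
      exact zero_le
    · have hle : ‖h‖ₑ ^ c ≤ ENNReal.ofReal (2 ^ j) ^ c := by
        rw [← ofReal_norm]
        exact ENNReal.rpow_le_rpow (ENNReal.ofReal_le_ofReal (mem_ball_zero_iff.1 hh).le) hc
      have hne : ‖h‖ₑ ^ c ≠ 0 := (ENNReal.rpow_pos (enorm_pos.2 h0) enorm_ne_top).ne'
      have hnt : ‖h‖ₑ ^ c ≠ ⊤ := ENNReal.rpow_ne_top_of_nonneg hc enorm_ne_top
      calc translateDist μ p (fun x => dyadicTrunc k (u x)) h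
          = ‖h‖ₑ ^ c * (translateDist μ p (fun x => dyadicTrunc k (u x)) h / ‖h‖ₑ ^ c) :=
            (ENNReal.mul_div_cancel hne hnt).symm
        _ ≤ _ := by gcongr

/-- An increment by `2h` is the sum of two increments by `h` with equal `L^p` norms, by translation
invariance. -/
theorem translateDist_two_smul_le {E : Type*} [NormedAddCommGroup E] [NormedSpace ℝ E]
    [MeasurableSpace E] [BorelSpace E] {μ : Measure E} [μ.IsAddHaarMeasure] {p : ℝ} (hp : 1 ≤ p)
    {w : E → ℝ} (hw : Measurable w) (h : E) :
    translateDist μ p w ((2 : ℝ) • h) ≤ 2 ^ p * translateDist μ p w h := by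
  unfold translateDist
  calc ∫⁻ x, ‖w (x + (2 : ℝ) • h) - w x‖ₑ ^ p ∂μ
      ≤ ∫⁻ x, 2 ^ (p - 1) * (‖w (x + h + h) - w (x + h)‖ₑ ^ p + ‖w (x + h) - w x‖ₑ ^ p) ∂μ := by
        refine lintegral_mono fun x => ?_
        refine le_trans (ENNReal.rpow_le_rpow ?_ (by linarith))
          (ENNReal.rpow_add_le_mul_rpow_add_rpow _ _ hp)
        rw [two_smul, ← add_assoc]
        refine le_trans (le_of_eq ?_) (enorm_add_le _ _)
        congr 1
        ring
    _ = 2 ^ (p - 1) * (∫⁻ x, ‖w (x + h) - w x‖ₑ ^ p ∂μ + ∫⁻ x, ‖w (x + h) - w x‖ₑ ^ p ∂μ) := by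
        rw [lintegral_const_mul _ (by fun_prop), lintegral_add_left (by fun_prop),
          lintegral_add_right_eq_self (fun x => ‖w (x + h) - w x‖ₑ ^ p) h]
    _ = _ := by
        rw [← two_mul, ← mul_assoc]
        congr 1
        nth_rw 2 [← ENNReal.rpow_one 2]
        rw [← ENNReal.rpow_add _ _ two_ne_zero ENNReal.ofNat_ne_top, sub_add_cancel]

theorem translateDist_two_pow_smul_le {E : Type*} [NormedAddCommGroup E] [NormedSpace ℝ E]
    [MeasurableSpace E] [BorelSpace E] {μ : Measure E} [μ.IsAddHaarMeasure] {p : ℝ} (hp : 1 ≤ p)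
    {w : E → ℝ} (hw : Measurable w) (h : E)
    (i : ℕ) : translateDist μ p w ((2 : ℝ) ^ i • h) ≤ (2 ^ p) ^ i * translateDist μ p w h := by
  induction i with
  | zero => simp
  | succ i ih =>
    rw [pow_succ', mul_smul, pow_succ', mul_assoc]
    exact (translateDist_two_smul_le hp hw _).trans (mul_le_mul_right ih _)

/-- No gradient of a layer is needed. The constant of level `k` is an integrated difference quotient
at one small scale `ρ`; the sum over the levels is controlled by the translation bound for `g`, and
larger radii follow by repeated doubling. -/
theorem hasDyadicSmoothness_one {p : ℝ} (hp : 1 ≤ p) {u g : E → ℝ} (hu : Measurable u)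
    (hug : ∀ x y, ‖u x - u y‖ₑ ≤ ‖g x - g y‖ₑ) {M : ℝ≥0∞}
    (hM : ∀ h, translateDist μ p g h ≤ ‖h‖ₑ ^ p * M) :
    HasDyadicSmoothness μ 1 p u (μ (ball 0 1) * M) := by
  intro J
  have hp0 : 0 < p := by linarith
  have hT : ∀ k, Measurable fun x => dyadicTrunc k (u x) := fun k =>
    (continuous_dyadicTrunc k).measurable.comp hu
  -- The base scale `2 ^ (-n)` lies below every radius considered, so each `2 ^ j` is `2 ^ i * ρ`
  -- with a natural number `i`. This is where the lower bound `J` on the scales is needed.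
  obtain ⟨n, hn⟩ : ∃ n : ℕ, -(n : ℤ) ≤ J := ⟨(-J).toNat, by omega⟩
  set ρ : ℝ := (2 ^ n)⁻¹ with hρ
  have hρ0 : 0 < ρ := by positivity
  refine ⟨fun k => ENNReal.ofReal ((2 ^ n) ^ p) *
    ∫⁻ z in ball (0 : E) 1, translateDist μ p (fun x => dyadicTrunc k (u x)) (ρ • z) ∂μ, ?_, ?_⟩
  · rw [ENNReal.tsum_mul_left, ← lintegral_tsum]
    · calc _ ≤ ENNReal.ofReal ((2 ^ n) ^ p) * ∫⁻ z in ball (0 : E) 1,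
              ENNReal.ofReal (ρ ^ p) * M ∂μ := by
            refine mul_le_mul_right (setLIntegral_mono' measurableSet_ball fun z hz => ?_) _
            refine (tsum_translateDist_dyadicTrunc_le hp hu hug _).trans ((hM _).trans ?_)
            refine mul_le_mul_left ?_ _
            rw [← ENNReal.ofReal_rpow_of_pos hρ0, ← ofReal_norm, norm_smul,
              Real.norm_of_nonneg hρ0.le]
            refine ENNReal.rpow_le_rpow (ENNReal.ofReal_le_ofReal ?_) hp0.le
            exact mul_le_of_le_one_right hρ0.le (mem_ball_zero_iff.1 hz).le
        _ = _ := by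
            rw [setLIntegral_const, ← mul_assoc, ← mul_assoc, ← ENNReal.ofReal_mul (by positivity),
              ← Real.mul_rpow (by positivity) hρ0.le, hρ, mul_inv_cancel₀ (by positivity),
              Real.one_rpow, ENNReal.ofReal_one, one_mul, mul_comm]
    · intro k
      exact ((measurable_translateDist μ p (hT k)).comp (measurable_const_smul ρ)).aemeasurable
  · intro k j hj
    obtain ⟨i, hi⟩ := Int.le.dest (hn.trans hj)
    have hr : (0 : ℝ) < 2 ^ j := by positivity
    have hji : (2 : ℝ) ^ j = 2 ^ i * ρ := by
      rw [← hi, zpow_add₀ two_ne_zero, zpow_neg, zpow_natCast, zpow_natCast, mul_comm]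
    rw [setLIntegral_ball_eq_smul μ _ hr, one_mul, Real.rpow_add hr, Real.rpow_natCast,
      ENNReal.ofReal_mul (by positivity), mul_assoc]
    refine mul_le_mul_right ?_ _
    rw [← mul_assoc, ← ENNReal.ofReal_mul (by positivity),
      ← Real.mul_rpow (by positivity) (by positivity), hji, mul_assoc, hρ,
      inv_mul_cancel₀ (by positivity), mul_one, ← lintegral_const_mul' _ _ ENNReal.ofReal_ne_top]
    refine lintegral_mono fun z => ?_
    rw [mul_smul]
    refine (translateDist_two_pow_smul_le hp (hT k) _ i).trans (le_of_eq ?_)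
    congr 1
    rw [← ENNReal.ofReal_rpow_of_pos (by positivity), ENNReal.ofReal_pow two_pos.le,
      ENNReal.ofReal_ofNat, ← ENNReal.rpow_natCast, ← ENNReal.rpow_natCast, ← ENNReal.rpow_mul,
      ← ENNReal.rpow_mul, mul_comm]

end Smoothness

/-! ### Translation estimates for functions with a weak gradient. -/

section WeakGradient

open Metric Set

variable {d : ℕ}

local notation "𝔼" => EuclideanSpace ℝ (Fin d)

theorem enorm_real_inner_le {F : Type*} [NormedAddCommGroup F] [InnerProductSpace ℝ F] (x y : F) :
    ‖(inner ℝ x y : ℝ)‖ₑ ≤ ‖x‖ₑ * ‖y‖ₑ := by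
  rw [← ofReal_norm, ← ofReal_norm, ← ofReal_norm, ← ENNReal.ofReal_mul (norm_nonneg _)]
  exact ENNReal.ofReal_le_ofReal (norm_inner_le_norm x y)

theorem IsWeakGradient.congr {g g' : 𝔼 → ℝ} {G G' : 𝔼 → 𝔼} (h : IsWeakGradient g G)
    (hg : g =ᵐ[volume] g') (hG : G =ᵐ[volume] G') : IsWeakGradient g' G' := by
  refine ⟨h.1.congr hg, h.2.1.congr hG, fun φ hφ hφc v => ?_⟩
  rw [← integral_congr_ae (hg.mono fun x hx => by simp only [hx] :
      (fun x => g x * fderiv ℝ φ x v) =ᵐ[volume] fun x => g' x * fderiv ℝ φ x v),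
    ← integral_congr_ae (hG.mono fun x hx => by simp only [hx] :
      (fun x => φ x * inner ℝ (G x) v) =ᵐ[volume] fun x => φ x * inner ℝ (G' x) v)]
  exact h.2.2 φ hφ hφc v

/-- This is the integrability behind the use of Fubini along segments: for `t` in `(0, 1]` the
translates stay in the ball of radius `R + ‖h‖`, where `G` is integrable. -/
theorem integrableOn_prod_comp_add_smul {G : 𝔼 → 𝔼} (hGm : Measurable G)
    (hG : LocallyIntegrable G volume) (h : 𝔼) (R : ℝ) :
    Integrable (fun z : 𝔼 × ℝ => inner ℝ (G (z.1 + z.2 • h)) h)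
      ((volume.restrict (closedBall 0 R)).prod (volume.restrict (Ioc (0 : ℝ) 1))) := by
  have hm : Measurable fun z : 𝔼 × ℝ => inner ℝ (G (z.1 + z.2 • h)) h := by fun_prop
  refine ⟨hm.aestronglyMeasurable, ?_⟩
  rw [hasFiniteIntegral_iff_enorm, lintegral_prod_symm _ hm.enorm.aemeasurable]
  have hfin : ∫⁻ x in closedBall (0 : 𝔼) (R + ‖h‖), ‖G x‖ₑ < ⊤ :=
    (hG.integrableOn_isCompact (isCompact_closedBall _ _)).2
  calc _ ≤ ∫⁻ t in Ioc (0 : ℝ) 1, (∫⁻ x in closedBall (0 : 𝔼) (R + ‖h‖), ‖G x‖ₑ) * ‖h‖ₑ := by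
        refine setLIntegral_mono' measurableSet_Ioc fun t ht => ?_
        calc _ ≤ ∫⁻ x in closedBall (0 : 𝔼) R, ‖G (x + t • h)‖ₑ * ‖h‖ₑ :=
              lintegral_mono fun x => enorm_real_inner_le _ _
          _ = (∫⁻ x in closedBall (0 : 𝔼) R, ‖G (x + t • h)‖ₑ) * ‖h‖ₑ :=
              lintegral_mul_const' _ _ enorm_ne_top
          _ ≤ _ := by
              refine mul_le_mul_left ?_ _
              rw [← lintegral_indicator measurableSet_closedBall,
                ← lintegral_indicator measurableSet_closedBall,
                ← lintegral_add_right_eq_self ((closedBall (0 : 𝔼) (R + ‖h‖)).indicator _) (t • h)]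
              refine lintegral_mono fun x => ?_
              by_cases hx : x ∈ closedBall (0 : 𝔼) R
              · rw [indicator_of_mem hx, indicator_of_mem]
                rw [mem_closedBall_zero_iff] at hx ⊢
                have : ‖t • h‖ ≤ ‖h‖ := by
                  rw [norm_smul, Real.norm_of_nonneg ht.1.le]
                  exact mul_le_of_le_one_left (norm_nonneg _) ht.2
                exact (norm_add_le _ _).trans (by linarith)
              · rw [indicator_of_notMem hx]; exact zero_le
    _ < ⊤ := by
        rw [setLIntegral_const]
        exact ENNReal.mul_lt_top (ENNReal.mul_lt_top hfin enorm_lt_top) (by simp)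

/-- Against a test function `φ`, the translation is moved onto `φ`. The fundamental theorem of
calculus is applied to `φ` along the segment, the weak gradient identity to each translate of `φ`,
and Fubini twice. -/
theorem IsWeakGradient.sub_ae_eq_integral {g : 𝔼 → ℝ} {G : 𝔼 → 𝔼} (hgG : IsWeakGradient g G)
    (hg : Integrable g volume) (hGm : Measurable G) (h : 𝔼) :
    ∀ᵐ x, g (x + h) - g x = ∫ t in Ioc (0 : ℝ) 1, inner ℝ (G (x + t • h)) h := by
  have hGl := hgG.2.1
  refine ae_eq_of_integral_contDiff_smul_eq ?_ ?_ ?_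
  · exact ((hg.comp_add_right h).sub hg).locallyIntegrable
  · rw [locallyIntegrable_iff]
    intro K hK
    obtain ⟨R, hR⟩ := hK.isBounded.subset_closedBall 0
    exact IntegrableOn.mono_set (integrableOn_prod_comp_add_smul hGm hGl h R).integral_prod_left hR
  intro φ hφ hφc
  have hφ1 : ContDiff ℝ 1 φ := hφ.of_le (by simp)
  have hdc : Continuous fun y => fderiv ℝ φ y h := by
    have := hφ1.continuous_fderiv one_ne_zero
    fun_prop
  obtain ⟨C, hC⟩ : ∃ C, ∀ x, ‖fderiv ℝ φ x h‖ ≤ C := by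
    refine hdc.bounded_above_of_compact_support ?_
    exact (hφc.fderiv (𝕜 := ℝ)).comp_left (g := fun L : 𝔼 →L[ℝ] ℝ => L h) rfl
  obtain ⟨Cφ, hCφ⟩ := hφ.continuous.bounded_above_of_compact_support hφc
  obtain ⟨R, hR⟩ := hφc.isCompact.isBounded.subset_closedBall 0
  have hφi : ∀ a : 𝔼, Integrable (fun x => φ (x - a) * g x) := fun a =>
    hg.bdd_mul (c := Cφ) (by have := hφ.continuous; fun_prop)
      (Filter.Eventually.of_forall fun x => hCφ _)
  have hftc : ∀ x, φ (x - h) - φ x = ∫ t in Ioc (0 : ℝ) 1, -fderiv ℝ φ (x - t • h) h := by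
    intro x
    have hder : ∀ t : ℝ, HasDerivAt (fun t : ℝ => φ (x - t • h)) (-fderiv ℝ φ (x - t • h) h) t := by
      intro t
      have h1 : HasDerivAt (fun t : ℝ => x - t • h) (-h) t := by
        simpa using ((hasDerivAt_id t).smul_const h).const_sub x
      have h2 := (hφ1.differentiable one_ne_zero (x - t • h)).hasFDerivAt.comp_hasDerivAt t h1
      rw [map_neg] at h2
      exact h2
    have := intervalIntegral.integral_eq_sub_of_hasDerivAt (a := 0) (b := 1)
      (fun t _ => hder t) (Continuous.intervalIntegrable (by fun_prop) _ _)
    rw [intervalIntegral.integral_of_le zero_le_one] at this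
    rw [this]
    simp
  have hF1 : Integrable (fun z : 𝔼 × ℝ => g z.1 * -fderiv ℝ φ (z.1 - z.2 • h) h)
      (volume.prod (volume.restrict (Ioc (0 : ℝ) 1))) := by
    have h1 : Integrable (fun z : 𝔼 × ℝ => g z.1) (volume.prod (volume.restrict (Ioc (0 : ℝ) 1))) :=
      hg.comp_fst _
    refine h1.mul_bdd (c := C) ?_ (Filter.Eventually.of_forall fun z => ?_)
    · exact Continuous.aestronglyMeasurable (by fun_prop)
    · rw [norm_neg]; exact hC _
  have hF2 : Integrable (fun z : 𝔼 × ℝ => φ z.1 * inner ℝ (G (z.1 + z.2 • h)) h)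
      (volume.prod (volume.restrict (Ioc (0 : ℝ) 1))) := by
    have h1 : Integrable (fun z : 𝔼 × ℝ => φ z.1 * inner ℝ (G (z.1 + z.2 • h)) h)
        ((volume.restrict (closedBall 0 R)).prod (volume.restrict (Ioc (0 : ℝ) 1))) :=
      (integrableOn_prod_comp_add_smul hGm hGl h R).bdd_mul (c := Cφ)
        (by have := hφ.continuous; exact Continuous.aestronglyMeasurable (by fun_prop))
        (Filter.Eventually.of_forall fun z => hCφ _)
    rw [← Measure.restrict_univ (μ := volume.restrict (Ioc (0 : ℝ) 1)),
      Measure.prod_restrict] at h1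
    refine IntegrableOn.integrable_of_forall_notMem_eq_zero h1 fun z hz => ?_
    have : z.1 ∉ tsupport φ := fun hz' => hz ⟨hR hz', mem_univ _⟩
    rw [image_eq_zero_of_notMem_tsupport this, zero_mul]
  simp only [smul_eq_mul]
  calc ∫ x, φ x * (g (x + h) - g x)
      = ∫ x, (φ (x - h) * g x - φ x * g x) := by
        have e1 : ∫ x, φ x * g (x + h) = ∫ x, φ (x - h) * g x := by
          rw [← integral_add_right_eq_self (fun x => φ (x - h) * g x) h]
          simp
        have i1 : Integrable fun x => φ x * g (x + h) := by
          simpa using (hφi h).comp_add_right h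
        have i0 : Integrable fun x => φ x * g x := by simpa using hφi 0
        simp_rw [mul_sub]
        rw [integral_sub i1 i0, integral_sub (hφi h) i0, e1]
    _ = ∫ x, ∫ t in Ioc (0 : ℝ) 1, g x * -fderiv ℝ φ (x - t • h) h := by
        refine integral_congr_ae (Filter.Eventually.of_forall fun x => ?_)
        simp only
        rw [integral_const_mul, ← hftc]
        ring
    _ = ∫ t in Ioc (0 : ℝ) 1, ∫ x, g x * -fderiv ℝ φ (x - t • h) h := integral_integral_swap hF1
    _ = ∫ t in Ioc (0 : ℝ) 1, ∫ x, φ x * inner ℝ (G (x + t • h)) h := by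
        refine integral_congr_ae (Filter.Eventually.of_forall fun t => ?_)
        simp only
        have hφt : ContDiff ℝ ∞ fun x => φ (x - t • h) := hφ.comp (by fun_prop)
        have hφtc : HasCompactSupport fun x => φ (x - t • h) := by
          simp_rw [sub_eq_add_neg]
          exact hφc.comp_homeomorph (Homeomorph.addRight (-(t • h)))
        have hw := hgG.2.2 _ hφt hφtc h
        simp_rw [fderiv_comp_sub] at hw
        simp_rw [mul_neg]
        rw [integral_neg, hw, neg_neg,
          ← integral_add_right_eq_self (fun x => φ (x - t • h) * inner ℝ (G x) h) (t • h)]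
        simp
    _ = ∫ x, ∫ t in Ioc (0 : ℝ) 1, φ x * inner ℝ (G (x + t • h)) h :=
        (integral_integral_swap hF2).symm
    _ = _ := by simp_rw [integral_const_mul]

/-- Jensen in `t` along the segment, then Tonelli and translation invariance. -/
theorem IsWeakGradient.translateDist_le {g : 𝔼 → ℝ} {G : 𝔼 → 𝔼} (hgG : IsWeakGradient g G)
    (hg : Integrable g volume) {p : ℝ} (hp : 1 ≤ p) (h : 𝔼) :
    translateDist volume p g h ≤ ‖h‖ₑ ^ p * ∫⁻ x, ‖G x‖ₑ ^ p := by
  have hp0 : 0 ≤ p := by linarith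
  wlog hGm : Measurable G generalizing G
  · have hae := hgG.2.1.aestronglyMeasurable
    have e := hae.ae_eq_mk
    rw [lintegral_congr_ae (e.mono fun x hx => by simp only [hx] :
      (fun x => ‖G x‖ₑ ^ p) =ᵐ[volume] fun x => ‖hae.mk G x‖ₑ ^ p)]
    exact this (hgG.congr (Filter.EventuallyEq.refl _ _) e) hae.stronglyMeasurable_mk.measurable
  have hpc : ‖h‖ₑ ^ p ≠ ⊤ := ENNReal.rpow_ne_top_of_nonneg hp0 enorm_ne_top
  calc translateDist volume p g h
      ≤ ∫⁻ x, ∫⁻ t in Ioc (0 : ℝ) 1, ‖h‖ₑ ^ p * ‖G (x + t • h)‖ₑ ^ p := by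
        refine lintegral_mono_ae ?_
        filter_upwards [hgG.sub_ae_eq_integral hg hGm h] with x hx
        rw [hx]
        calc _ ≤ (∫⁻ t in Ioc (0 : ℝ) 1, ‖h‖ₑ * ‖G (x + t • h)‖ₑ) ^ p := by
              refine ENNReal.rpow_le_rpow ((enorm_integral_le_lintegral_enorm _).trans ?_) hp0
              refine lintegral_mono fun t => ?_
              rw [mul_comm]
              exact enorm_real_inner_le _ _
          _ ≤ _ := rpow_lintegral_le hp (by fun_prop)
          _ = _ := by
              simp only [Measure.restrict_apply_univ, Real.volume_Ioc, sub_zero,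
                ENNReal.ofReal_one, ENNReal.one_rpow, one_mul]
              simp_rw [ENNReal.mul_rpow_of_nonneg _ _ hp0]
    _ = ∫⁻ t in Ioc (0 : ℝ) 1, ∫⁻ x, ‖h‖ₑ ^ p * ‖G (x + t • h)‖ₑ ^ p :=
        lintegral_lintegral_swap (by fun_prop)
    _ = ∫⁻ t in Ioc (0 : ℝ) 1, ‖h‖ₑ ^ p * ∫⁻ x, ‖G x‖ₑ ^ p := by
        refine lintegral_congr fun t => ?_
        rw [lintegral_const_mul' _ _ hpc, lintegral_add_right_eq_self (fun x => ‖G x‖ₑ ^ p)]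
    _ = _ := by simp

end WeakGradient

/-! ### The inequality for integrable functions. -/

section CoulombSobolev

open Metric Set Module

variable {d : ℕ}

local notation "𝔼" => EuclideanSpace ℝ (Fin d)

theorem IsWeakGradient.congr_left_iff {g g' : 𝔼 → ℝ} {G : 𝔼 → 𝔼} (hg : g =ᵐ[volume] g') :
    IsWeakGradient g G ↔ IsWeakGradient g' G :=
  ⟨fun h => h.congr hg (Filter.EventuallyEq.refl _ _),
    fun h => h.congr hg.symm (Filter.EventuallyEq.refl _ _)⟩

theorem sobolevSeminorm_congr_ae (s p : ℝ) {g g' : 𝔼 → ℝ} (h : g =ᵐ[volume] g') :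
    sobolevSeminorm s p g = sobolevSeminorm s p g' := by
  unfold sobolevSeminorm
  split_ifs
  · congr 1
    exact lintegral_congr_ae (h.mono fun x hx => by simp only [hx])
  · simp_rw [IsWeakGradient.congr_left_iff h]
  · congr 1
    refine lintegral_congr_ae (h.mono fun x hx => ?_)
    exact lintegral_congr_ae (h.mono fun y hy => by simp only [hx, hy])

theorem coulombEnergy_congr_ae (α q : ℝ) {g g' : 𝔼 → ℝ} (h : g =ᵐ[volume] g') :
    coulombEnergy α q g = coulombEnergy α q g' := by
  refine lintegral_congr_ae (h.mono fun x hx => ?_)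
  exact lintegral_congr_ae (h.mono fun y hy => by simp only [hx, hy])

theorem translateDist_le_sobolevSeminorm_one {g : 𝔼 → ℝ} (hg : Integrable g volume) {p : ℝ}
    (hp : 1 ≤ p) (h : 𝔼) :
    translateDist volume p g h ≤ ‖h‖ₑ ^ p * sobolevSeminorm 1 p g ^ p := by
  have hp0 : 0 < p := by linarith
  rcases eq_or_ne h 0 with rfl | h0
  · simp [translateDist, hp0]
  -- Dividing by `‖h‖ₑ` isolates the infimum over weak gradients, so that each gradient can be
  -- treated separately.
  rw [← ENNReal.mul_rpow_of_nonneg _ _ hp0.le, ← ENNReal.rpow_inv_le_iff hp0, mul_comm,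
    ← ENNReal.div_le_iff (enorm_ne_zero.2 h0) enorm_ne_top]
  simp only [sobolevSeminorm, one_ne_zero, if_false, if_true]
  refine le_iInf₂ fun G hG => ?_
  rw [ENNReal.div_le_iff (enorm_ne_zero.2 h0) enorm_ne_top, mul_comm, ENNReal.rpow_inv_le_iff hp0,
    ENNReal.mul_rpow_of_nonneg _ _ hp0.le, ← ENNReal.rpow_mul, one_div_mul_cancel hp0.ne',
    ENNReal.rpow_one]
  exact hG.translateDist_le hg hp h

/-- Every function whose increments are dominated by those of `g` has dyadic smoothness controlled
by the Sobolev seminorm of `g`. -/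
theorem hasDyadicSmoothness_sobolevSeminorm {s p : ℝ} (hs₀ : 0 < s) (hs₁ : s ≤ 1) (hp : 1 ≤ p)
    {u g : 𝔼 → ℝ} (hu : Measurable u) (hg : Measurable g) (hgi : Integrable g volume)
    (hug : ∀ x y, ‖u x - u y‖ₑ ≤ ‖g x - g y‖ₑ) :
    HasDyadicSmoothness volume s p u
      ((volume (ball (0 : 𝔼) 1) + 1) * sobolevSeminorm s p g ^ p) := by
  have mono : ∀ N N', N ≤ N' → HasDyadicSmoothness volume s p u N →
      HasDyadicSmoothness volume s p u N' := fun N N' hN h J => by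
    obtain ⟨a, ha, ha'⟩ := h J
    exact ⟨a, ha.trans hN, ha'⟩
  rcases hs₁.eq_or_lt with rfl | hs₁
  · refine mono _ _ (mul_le_mul_left le_self_add _) (hasDyadicSmoothness_one hp hu hug ?_)
    exact translateDist_le_sobolevSeminorm_one hgi hp
  · refine mono _ _ ?_ (hasDyadicSmoothness_of_gagliardo hs₀.le hp hu hg hug)
    refine le_trans (le_of_eq ?_) (mul_le_mul_left le_add_self _)
    simp only [sobolevSeminorm, hs₀.ne', hs₁.ne, if_false]
    rw [one_mul, ← ENNReal.rpow_mul, one_div_mul_cancel (by linarith), ENNReal.rpow_one,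
      finrank_euclideanSpace_fin]

theorem enorm_min_abs_sub_le (a b M : ℝ) : ‖min |a| M - min |b| M‖ₑ ≤ ‖a - b‖ₑ := by
  rw [Real.enorm_eq_ofReal_abs, Real.enorm_eq_ofReal_abs]
  refine ENNReal.ofReal_le_ofReal ((abs_min_sub_min_le_max _ _ _ _).trans ?_)
  rw [sub_self, abs_zero]
  exact max_le (abs_abs_sub_abs_le _ _) (abs_nonneg _)

/-- Absorbing half of `∫ u ^ γ` requires it to be finite, which is not known for `g`. A bounded
integrable function does lie in `L^γ`. -/
theorem lintegral_min_rpow_ne_top {X : Type*} [MeasurableSpace X] {ν : Measure X} {g : X → ℝ}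
    (hg : Integrable g ν) {γ M : ℝ} (hγ : 1 ≤ γ) (hM : 0 ≤ M) :
    ∫⁻ x, ‖min |g x| M‖ₑ ^ γ ∂ν ≠ ⊤ := by
  have hc : ENNReal.ofReal M ^ (γ - 1) ≠ ⊤ :=
    ENNReal.rpow_ne_top_of_nonneg (by linarith) ENNReal.ofReal_ne_top
  refine ne_top_of_le_ne_top (ENNReal.mul_ne_top hc hg.2.ne) ?_
  rw [← lintegral_const_mul' _ _ hc]
  refine lintegral_mono fun x => ?_
  have h0 : 0 ≤ min |g x| M := le_min (abs_nonneg _) hM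
  have h1 : ‖min |g x| M‖ₑ ≤ ENNReal.ofReal M := by
    rw [Real.enorm_of_nonneg h0]; exact ENNReal.ofReal_le_ofReal (min_le_right _ _)
  have h2 : ‖min |g x| M‖ₑ ≤ ‖g x‖ₑ := by
    rw [Real.enorm_of_nonneg h0, Real.enorm_eq_ofReal_abs]
    exact ENNReal.ofReal_le_ofReal (min_le_left _ _)
  calc ‖min |g x| M‖ₑ ^ γ = ‖min |g x| M‖ₑ ^ (γ - 1) * ‖min |g x| M‖ₑ := by
        nth_rw 3 [← ENNReal.rpow_one ‖min |g x| M‖ₑ]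
        rw [← ENNReal.rpow_add_of_nonneg _ _ (by linarith) zero_le_one, sub_add_cancel]
    _ ≤ _ := by
        refine mul_le_mul' (ENNReal.rpow_le_rpow h1 (by linarith)) h2

theorem rpow_lintegral_le_of_forall_min {X : Type*} [MeasurableSpace X] {ν : Measure X} {g : X → ℝ}
    (hg : Measurable g) {γ : ℝ} (hγ : 0 < γ) {B : ℝ≥0∞}
    (h : ∀ M : ℕ, (∫⁻ x, ‖min |g x| M‖ₑ ^ γ ∂ν) ^ (1 / γ) ≤ B) :
    (∫⁻ x, ‖g x‖ₑ ^ γ ∂ν) ^ (1 / γ) ≤ B := by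
  have ht := lintegral_tendsto_of_tendsto_of_monotone (μ := ν)
    (f := fun (M : ℕ) x => ‖min |g x| M‖ₑ ^ γ) (F := fun x => ‖g x‖ₑ ^ γ)
    (fun M => by fun_prop)
    (Filter.Eventually.of_forall fun x M M' hM => by
      refine ENNReal.rpow_le_rpow ?_ hγ.le
      rw [Real.enorm_of_nonneg (by positivity), Real.enorm_of_nonneg (by positivity)]
      gcongr)
    (Filter.Eventually.of_forall fun x => by
      refine tendsto_const_nhds.congr' ?_
      obtain ⟨M₀, hM₀⟩ := exists_nat_ge |g x|
      filter_upwards [Filter.eventually_ge_atTop M₀] with M hM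
      have : |g x| ≤ M := hM₀.trans (by exact_mod_cast hM)
      rw [min_eq_left this, Real.enorm_abs])
  exact le_of_tendsto' ((ENNReal.continuous_rpow_const.tendsto _).comp ht) h

theorem exists_eLpNorm_le_sobolevSeminorm_mul_coulombEnergy
    (hd : 1 ≤ d) {s γ p q α β₁ β₂ : ℝ} (hs₀ : 0 ≤ s) (hs₁ : s ≤ 1) (hγ : 1 < γ)
    (hp : 1 ≤ p) (hq : 1 ≤ q) (hα₀ : 0 < α) (hαd : α < d) (hβ₁ : 0 < β₁) (hβ₂ : 0 < β₂)
    (hscal₁ : β₁ * p + 2 * β₂ * q = 1)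
    (hscal₂ : ((d : ℝ) - s * p) * β₁ + ((d : ℝ) + α) * β₂ = d / γ)
    (hcond : 1 ≤ β₁ * γ + β₂ * γ) :
    ∃ C : ℝ≥0, 0 < C ∧ ∀ g : 𝔼 → ℝ, Integrable g volume →
      eLpNorm g (ENNReal.ofReal γ) volume ≤
        C * sobolevSeminorm s p g ^ (β₁ * p) * coulombEnergy α q g ^ β₂ := by
  have hγ0 : 0 < γ := by linarith
  -- For `s = 0` the second scaling relation reads `d(β₁ + β₂)γ + αβ₂γ = d`, which is incompatible
  -- with `β₁γ + β₂γ ≥ 1` because `αβ₂γ > 0`.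
  have hs : 0 < s := by
    rcases hs₀.eq_or_lt with rfl | h
    · exfalso
      have hd0 : (0 : ℝ) < d := by exact_mod_cast hd
      rw [zero_mul, sub_zero, eq_div_iff hγ0.ne'] at hscal₂
      have h1 : 0 < α * β₂ * γ := by positivity
      have h2 : (d : ℝ) * 1 ≤ d * (β₁ * γ + β₂ * γ) := mul_le_mul_of_nonneg_left hcond hd0.le
      nlinarith
    · exact h
  have hfin : finrank ℝ 𝔼 = d := finrank_euclideanSpace_fin
  obtain ⟨C, hC, hmain⟩ := exists_lintegral_rpow_le (volume : Measure 𝔼) (by rwa [hfin]) hp hq hγ.le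
    hα₀ (by rwa [hfin]) hβ₁ hβ₂ hscal₁ (by rwa [hfin]) hcond
  set w := volume (ball (0 : 𝔼) 1) + 1 with hw
  have hwt : w ≠ ⊤ := ENNReal.add_ne_top.2 ⟨measure_ball_lt_top.ne, ENNReal.one_ne_top⟩
  have hw0 : 0 < w.toNNReal := ENNReal.toNNReal_pos (by rw [hw]; simp) hwt
  refine ⟨C * w.toNNReal ^ β₁, mul_pos hC (NNReal.rpow_pos hw0), fun g hgi => ?_⟩
  wlog hg : Measurable g generalizing g
  · have e := hgi.1.ae_eq_mk
    rw [eLpNorm_congr_ae e, sobolevSeminorm_congr_ae s p e, coulombEnergy_congr_ae α q e]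
    exact this _ (hgi.congr e) hgi.1.stronglyMeasurable_mk.measurable
  rw [eLpNorm_eq_lintegral_rpow_enorm_toReal (by simpa using hγ0) ENNReal.ofReal_ne_top,
    ENNReal.toReal_ofReal hγ0.le]
  refine rpow_lintegral_le_of_forall_min hg hγ0 fun M => ?_
  have hu : Measurable fun x => min |g x| (M : ℝ) := by fun_prop
  have hu0 : ∀ x, 0 ≤ min |g x| (M : ℝ) := fun x => by positivity
  refine (hmain _ (fun x => ‖g x‖ₑ ^ q) _ hu hu0 (by fun_prop) (fun x => ?_)
    (lintegral_min_rpow_ne_top hgi hγ.le (Nat.cast_nonneg M))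
    (hasDyadicSmoothness_sobolevSeminorm hs hs₁ hp hu hg hgi fun x y =>
      enorm_min_abs_sub_le _ _ _)).trans (le_of_eq ?_)
  · refine ENNReal.rpow_le_rpow ?_ (by linarith)
    rw [Real.enorm_of_nonneg (hu0 x), Real.enorm_eq_ofReal_abs]
    exact ENNReal.ofReal_le_ofReal (min_le_left _ _)
  · rw [ENNReal.mul_rpow_of_nonneg _ _ hβ₁.le, ← ENNReal.rpow_mul, mul_comm p, ENNReal.coe_mul,
      ENNReal.coe_rpow_of_nonneg _ hβ₁.le, ENNReal.coe_toNNReal hwt, hfin, ← mul_assoc (C : ℝ≥0∞)]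
    rfl

end CoulombSobolev

/-! ### Sums with disjoint supports, and finiteness of the functionals on test functions. -/

section Bumps

open Metric Set Module

variable {d : ℕ}

local notation "𝔼" => EuclideanSpace ℝ (Fin d)

theorem enorm_sum_rpow_of_pairwise {ι F : Type*} [NormedAddCommGroup F] (I : Finset ι)
    {c : ι → F} (hc : ∀ i ∈ I, ∀ j ∈ I, i ≠ j → c i = 0 ∨ c j = 0) {q : ℝ} (hq : 0 < q) :
    ‖∑ i ∈ I, c i‖ₑ ^ q = ∑ i ∈ I, ‖c i‖ₑ ^ q := by
  by_cases h : ∃ i ∈ I, c i ≠ 0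
  · obtain ⟨i, hi, hne⟩ := h
    have h0 : ∀ j ∈ I, j ≠ i → c j = 0 := fun j hj hji => (hc j hj i hi hji).resolve_right hne
    rw [Finset.sum_eq_single_of_mem i hi h0, Finset.sum_eq_single_of_mem i hi]
    intro j hj hji
    rw [h0 j hj hji, enorm_zero, ENNReal.zero_rpow_of_pos hq]
  · push Not at h
    rw [Finset.sum_eq_zero h, enorm_zero, ENNReal.zero_rpow_of_pos hq, Finset.sum_eq_zero]
    intro j hj
    rw [h j hj, enorm_zero, ENNReal.zero_rpow_of_pos hq]

/-- Each family has at most one nonzero member, so at most two indices contribute to the difference;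
the power mean inequality for two terms gives the constant. -/
theorem enorm_sum_sub_sum_rpow_le {ι F : Type*} [NormedAddCommGroup F] (I : Finset ι)
    {c c' : ι → F} (hc : ∀ i ∈ I, ∀ j ∈ I, i ≠ j → c i = 0 ∨ c j = 0)
    (hc' : ∀ i ∈ I, ∀ j ∈ I, i ≠ j → c' i = 0 ∨ c' j = 0) {p : ℝ} (hp : 1 ≤ p) :
    ‖∑ i ∈ I, c i - ∑ i ∈ I, c' i‖ₑ ^ p ≤ 2 ^ (p - 1) * ∑ i ∈ I, ‖c i - c' i‖ₑ ^ p := by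
  classical
  set S := I.filter fun i => c i ≠ 0 ∨ c' i ≠ 0 with hS
  have card_le_one : ∀ b : ι → F, (∀ i ∈ I, ∀ j ∈ I, i ≠ j → b i = 0 ∨ b j = 0) →
      (I.filter fun i => b i ≠ 0).card ≤ 1 := by
    intro b hb
    refine Finset.card_le_one.2 fun i hi j hj => ?_
    rw [Finset.mem_filter] at hi hj
    by_contra hij
    rcases hb i hi.1 j hj.1 hij with h | h
    · exact hi.2 h
    · exact hj.2 h
  have hcard : S.card ≤ 2 := by
    rw [hS, Finset.filter_or]
    have h1 := card_le_one c hc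
    have h2 := card_le_one c' hc'
    exact (Finset.card_union_le _ _).trans (by omega)
  have hsum : ∑ i ∈ I, c i - ∑ i ∈ I, c' i = ∑ i ∈ S, (c i - c' i) := by
    rw [← Finset.sum_sub_distrib, hS, Finset.sum_filter_of_ne]
    intro i _ hne
    by_contra! h
    rw [h.1, h.2, sub_zero] at hne
    exact hne rfl
  rw [hsum]
  calc ‖∑ i ∈ S, (c i - c' i)‖ₑ ^ p ≤ (∑ i ∈ S, ‖c i - c' i‖ₑ) ^ p :=
        ENNReal.rpow_le_rpow (enorm_sum_le _ _) (by linarith)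
    _ ≤ (S.card : ℝ≥0∞) ^ (p - 1) * ∑ i ∈ S, ‖c i - c' i‖ₑ ^ p :=
        ENNReal.rpow_sum_le_const_mul_sum_rpow _ _ hp
    _ ≤ _ := by
        refine mul_le_mul' (ENNReal.rpow_le_rpow (by exact_mod_cast hcard) (by linarith)) ?_
        exact Finset.sum_le_sum_of_subset (Finset.filter_subset _ _)

theorem lintegral_enorm_rpow_lt_top_of_hasCompactSupport {F : Type*} [NormedAddCommGroup F]
    {f : 𝔼 → F} (hf : Continuous f) (hc : HasCompactSupport f) {q : ℝ} (hq : 0 < q) :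
    ∫⁻ x, ‖f x‖ₑ ^ q < ⊤ := by
  have h := (hf.memLp_of_hasCompactSupport (p := ENNReal.ofReal q) (μ := volume) hc).eLpNorm_lt_top
  have := lintegral_rpow_enorm_lt_top_of_eLpNorm_lt_top (by simpa using hq) ENNReal.ofReal_ne_top h
  rwa [ENNReal.toReal_ofReal hq.le] at this

/-- The classical gradient of a smooth function as a vector field. -/
noncomputable def gradientField (g : 𝔼 → ℝ) (x : 𝔼) : 𝔼 :=
  (InnerProductSpace.toDual ℝ 𝔼).symm (fderiv ℝ g x)

theorem enorm_gradientField (g : 𝔼 → ℝ) (x : 𝔼) : ‖gradientField g x‖ₑ = ‖fderiv ℝ g x‖ₑ := by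
  rw [← ofReal_norm, ← ofReal_norm, gradientField, LinearIsometryEquiv.norm_map]

theorem isWeakGradient_gradientField {g : 𝔼 → ℝ} (hg : ContDiff ℝ ∞ g)
    (hgc : HasCompactSupport g) : IsWeakGradient g (gradientField g) := by
  have hg1 : ContDiff ℝ 1 g := hg.of_le (by simp)
  have hdc := hg1.continuous_fderiv one_ne_zero
  refine ⟨hg.continuous.locallyIntegrable, ?_, ?_⟩
  · refine Continuous.locallyIntegrable ?_
    exact (InnerProductSpace.toDual ℝ 𝔼).symm.continuous.comp hdc
  · intro φ hφ hφc v
    have hφ1 : ContDiff ℝ 1 φ := hφ.of_le (by simp)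
    have hφd := hφ1.continuous_fderiv one_ne_zero
    have hgcont := hg.continuous
    have hφcont := hφ.continuous
    rw [integral_mul_fderiv_eq_neg_fderiv_mul_of_integrable]
    · congr 1
      refine integral_congr_ae (Filter.Eventually.of_forall fun x => ?_)
      simp only [gradientField, InnerProductSpace.toDual_symm_apply]
      ring
    · exact Continuous.integrable_of_hasCompactSupport (by fun_prop) hφc.mul_left
    · exact Continuous.integrable_of_hasCompactSupport (by fun_prop) hgc.mul_right
    · exact Continuous.integrable_of_hasCompactSupport (by fun_prop) hgc.mul_right
    · exact fun x _ => hg1.differentiable one_ne_zero x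
    · exact fun x _ => hφ1.differentiable one_ne_zero x

theorem translateDist_le_two_rpow_mul {p : ℝ} (hp : 1 ≤ p) {g : 𝔼 → ℝ} (hg : Measurable g)
    (h : 𝔼) : translateDist volume p g h ≤ 2 ^ p * ∫⁻ x, ‖g x‖ₑ ^ p := by
  unfold translateDist
  calc ∫⁻ x, ‖g (x + h) - g x‖ₑ ^ p
      ≤ ∫⁻ x, 2 ^ (p - 1) * (‖g (x + h)‖ₑ ^ p + ‖g x‖ₑ ^ p) := by
        refine lintegral_mono fun x => ?_
        exact le_trans (ENNReal.rpow_le_rpow (enorm_sub_le) (by linarith))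
          (ENNReal.rpow_add_le_mul_rpow_add_rpow _ _ hp)
    _ = 2 ^ (p - 1) * ((∫⁻ x, ‖g x‖ₑ ^ p) + ∫⁻ x, ‖g x‖ₑ ^ p) := by
        rw [lintegral_const_mul _ (by fun_prop), lintegral_add_left (by fun_prop),
          lintegral_add_right_eq_self (fun x => ‖g x‖ₑ ^ p) h]
    _ = _ := by
        rw [← two_mul, ← mul_assoc]
        congr 1
        nth_rw 2 [← ENNReal.rpow_one 2]
        rw [← ENNReal.rpow_add _ _ two_ne_zero ENNReal.ofNat_ne_top, sub_add_cancel]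

/-- For `|h| < 1` the gradient bound leaves `|h| ^ (p - d - sp)`, integrable since `s < 1`. For `|h|
≥ 1` the `L^p` bound leaves `|h| ^ (-d - sp)`, integrable since `s > 0`. -/
theorem lintegral_gagliardo_lt_top (hd : 1 ≤ d) {s p : ℝ} (hs₀ : 0 < s) (hs₁ : s < 1) (hp : 1 ≤ p)
    {g : 𝔼 → ℝ} (hg : ContDiff ℝ ∞ g) (hgc : HasCompactSupport g) :
    ∫⁻ x, ∫⁻ y, ‖g x - g y‖ₑ ^ p / ‖x - y‖ₑ ^ ((d : ℝ) + s * p) < ⊤ := by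
  have hp0 : 0 < p := by linarith
  have hfin : finrank ℝ 𝔼 = d := finrank_euclideanSpace_fin
  have hg1 : ContDiff ℝ 1 g := hg.of_le (by simp)
  have hM₀ := lintegral_enorm_rpow_lt_top_of_hasCompactSupport hg.continuous hgc hp0
  have hM₁ := lintegral_enorm_rpow_lt_top_of_hasCompactSupport
    (hg1.continuous_fderiv one_ne_zero) (hgc.fderiv (𝕜 := ℝ)) hp0
  have htd := (isWeakGradient_gradientField hg hgc).translateDist_le
    (hg.continuous.integrable_of_hasCompactSupport hgc) hp
  simp_rw [enorm_gradientField] at htd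
  set M₀ := ∫⁻ x, ‖g x‖ₑ ^ p
  set M₁ := ∫⁻ x, ‖fderiv ℝ g x‖ₑ ^ p
  have h2t : (2 : ℝ≥0∞) ^ p ≠ ⊤ := ENNReal.rpow_ne_top_of_nonneg hp0.le ENNReal.ofNat_ne_top
  rw [lintegral_gagliardo_eq volume hg.continuous.measurable,
    ← lintegral_add_compl _ (measurableSet_ball (x := (0 : 𝔼)) (ε := 1))]
  refine ENNReal.add_lt_top.2 ⟨?_, ?_⟩
  · calc _ ≤ ∫⁻ h in ball (0 : 𝔼) 1, M₁ * ‖h‖ₑ ^ (-((d : ℝ) + s * p - p)) := by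
          refine lintegral_mono fun h => ?_
          rcases eq_or_ne h 0 with rfl | h0
          · have : translateDist volume p g 0 = 0 := by simp [translateDist, hp0]
            simp only [this]
            simp
          calc _ ≤ ‖h‖ₑ ^ p * M₁ / ‖h‖ₑ ^ ((d : ℝ) + s * p) := ENNReal.div_le_div_right (htd h) _
            _ = _ := by
              rw [div_eq_mul_inv, ← ENNReal.rpow_neg, mul_comm _ M₁, mul_assoc,
                ← ENNReal.rpow_add _ _ (enorm_ne_zero.2 h0) enorm_ne_top]
              congr 2
              ring
      _ < ⊤ := by
          rw [lintegral_const_mul' _ _ hM₁.ne]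
          refine ENNReal.mul_lt_top hM₁
            (setLIntegral_ball_enorm_rpow_lt_top volume (by rwa [hfin]) ?_ 1)
          rw [hfin]
          nlinarith
  · calc _ ≤ ∫⁻ h in (ball (0 : 𝔼) 1)ᶜ, 2 ^ p * M₀ * ‖h‖ₑ ^ (-((d : ℝ) + s * p)) := by
          refine lintegral_mono fun h => ?_
          rw [ENNReal.rpow_neg, ← div_eq_mul_inv]
          exact ENNReal.div_le_div_right
            (translateDist_le_two_rpow_mul hp hg.continuous.measurable h) _
      _ < ⊤ := by
          rw [lintegral_const_mul' _ _ (ENNReal.mul_ne_top h2t hM₀.ne)]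
          refine ENNReal.mul_lt_top (ENNReal.mul_lt_top h2t.lt_top hM₀)
            (setLIntegral_compl_ball_enorm_rpow_lt_top volume ?_ one_pos)
          rw [hfin]
          have : 0 < s * p := by positivity
          linarith

/-- The potential of `|g|^q` is bounded uniformly in `x`: near `x` the function is bounded and the
kernel integrable, and away from `x` the kernel is at most one. -/
theorem coulombEnergy_lt_top (hd : 1 ≤ d) {α q : ℝ} (hα₀ : 0 < α) (hαd : α < d) (hq : 0 < q)
    {g : 𝔼 → ℝ} (hg : Continuous g) (hgc : HasCompactSupport g) : coulombEnergy α q g < ⊤ := by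
  have hfin : finrank ℝ 𝔼 = d := finrank_euclideanSpace_fin
  have hM₀ := lintegral_enorm_rpow_lt_top_of_hasCompactSupport hg hgc hq
  obtain ⟨B, hB⟩ := hg.bounded_above_of_compact_support hgc
  have hK : ∫⁻ h in ball (0 : 𝔼) 1, ‖h‖ₑ ^ (-((d : ℝ) - α)) < ⊤ :=
    setLIntegral_ball_enorm_rpow_lt_top volume (by rwa [hfin]) (by rw [hfin]; linarith) 1
  set M₀ := ∫⁻ x, ‖g x‖ₑ ^ q
  set K := ∫⁻ h in ball (0 : 𝔼) 1, ‖h‖ₑ ^ (-((d : ℝ) - α))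
  have hBt : ENNReal.ofReal B ^ q ≠ ⊤ := ENNReal.rpow_ne_top_of_nonneg hq.le ENNReal.ofReal_ne_top
  have hinner : ∀ x : 𝔼, ∫⁻ y, ‖g y‖ₑ ^ q / ‖x - y‖ₑ ^ ((d : ℝ) - α) ≤
      ENNReal.ofReal B ^ q * K + M₀ := by
    intro x
    rw [← lintegral_add_left_eq_self _ x,
      ← lintegral_add_compl _ (measurableSet_ball (x := (0 : 𝔼)) (ε := 1))]
    simp only [sub_add_cancel_left, enorm_neg]
    refine add_le_add ?_ ?_
    · rw [← lintegral_const_mul' _ _ hBt]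
      refine lintegral_mono fun h => ?_
      rw [div_eq_mul_inv, ← ENNReal.rpow_neg]
      refine mul_le_mul_left (ENNReal.rpow_le_rpow ?_ hq.le) _
      rw [← ofReal_norm]
      exact ENNReal.ofReal_le_ofReal (hB _)
    · calc _ ≤ ∫⁻ h in (ball (0 : 𝔼) 1)ᶜ, ‖g (x + h)‖ₑ ^ q := by
            refine setLIntegral_mono' measurableSet_ball.compl fun h hh => ?_
            refine ENNReal.div_le_of_le_mul (le_mul_of_one_le_right' ?_)
            refine ENNReal.one_le_rpow ?_ (by linarith)
            have : 1 ≤ ‖h‖ := by simpa using hh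
            rw [← ofReal_norm, ← ENNReal.ofReal_one]
            exact ENNReal.ofReal_le_ofReal this
        _ ≤ ∫⁻ h, ‖g (x + h)‖ₑ ^ q := setLIntegral_le_lintegral _ _
        _ = M₀ := lintegral_add_left_eq_self (fun y => ‖g y‖ₑ ^ q) x
  calc coulombEnergy α q g
      = ∫⁻ x, ‖g x‖ₑ ^ q * ∫⁻ y, ‖g y‖ₑ ^ q / ‖x - y‖ₑ ^ ((d : ℝ) - α) := by
        refine lintegral_congr fun x => ?_
        rw [← lintegral_const_mul' _ _ (ENNReal.rpow_ne_top_of_nonneg hq.le enorm_ne_top)]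
        simp_rw [mul_div_assoc]
    _ ≤ ∫⁻ x, ‖g x‖ₑ ^ q * (ENNReal.ofReal B ^ q * K + M₀) :=
        lintegral_mono fun x => mul_le_mul_right (hinner x) _
    _ < ⊤ := by
        have : ENNReal.ofReal B ^ q * K + M₀ < ⊤ :=
          ENNReal.add_lt_top.2 ⟨ENNReal.mul_lt_top hBt.lt_top hK, hM₀⟩
        rw [lintegral_mul_const' _ _ this.ne]
        exact ENNReal.mul_lt_top hM₀ this

end Bumps

/-! ### Optimality by many distant copies of a bump. -/

section Sharpness

open Metric Set Module

variable {d : ℕ}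

local notation "𝔼" => EuclideanSpace ℝ (Fin d)

/-- The sum of the translates of `φ` by `a 0, …, a (m - 1)`. -/
def sumTranslates (φ : 𝔼 → ℝ) (a : ℕ → 𝔼) (m : ℕ) (x : 𝔼) : ℝ :=
  ∑ i ∈ Finset.range m, φ (x - a i)

theorem contDiff_sumTranslates {φ : 𝔼 → ℝ} (hφ : ContDiff ℝ ∞ φ) (a : ℕ → 𝔼) (m : ℕ) :
    ContDiff ℝ ∞ (sumTranslates φ a m) :=
  ContDiff.sum fun i _ => hφ.comp (by fun_prop)

theorem hasCompactSupport_sumTranslates {φ : 𝔼 → ℝ} (hφ : HasCompactSupport φ) (a : ℕ → 𝔼)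
    (m : ℕ) : HasCompactSupport (sumTranslates φ a m) := by
  unfold sumTranslates
  induction m with
  | zero =>
    simp only [Finset.range_zero, Finset.sum_empty]
    exact HasCompactSupport.zero
  | succ m ih =>
    simp_rw [Finset.sum_range_succ]
    refine HasCompactSupport.add ih ?_
    simp_rw [sub_eq_add_neg]
    exact hφ.comp_homeomorph (Homeomorph.addRight (-(a m)))

theorem eq_zero_or_eq_zero_of_separated {F : Type*} [Zero F] {f : 𝔼 → F}
    (hf : ∀ x, 1 < ‖x‖ → f x = 0) {a : ℕ → 𝔼} {L : ℝ} (hL : 4 ≤ L)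
    (ha : ∀ i j, i ≠ j → L ≤ ‖a i - a j‖) (x : 𝔼) (I : Finset ℕ) :
    ∀ i ∈ I, ∀ j ∈ I, i ≠ j → f (x - a i) = 0 ∨ f (x - a j) = 0 := by
  intro i _ j _ hij
  by_contra! h
  have h1 : ‖x - a i‖ ≤ 1 := not_lt.1 fun h' => h.1 (hf _ h')
  have h2 : ‖x - a j‖ ≤ 1 := not_lt.1 fun h' => h.2 (hf _ h')
  have h3 := ha i j hij
  have h4 : ‖a i - a j‖ ≤ ‖x - a j‖ + ‖x - a i‖ := by
    rw [← sub_sub_sub_cancel_left (a j) (a i) x]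
    exact norm_sub_le _ _
  linarith

theorem lintegral_sum_translates_rpow {F : Type*} [NormedAddCommGroup F] {f : 𝔼 → F}
    (hfc : Continuous f) (hf : ∀ x, 1 < ‖x‖ → f x = 0) {a : ℕ → 𝔼} {L : ℝ} (hL : 4 ≤ L)
    (ha : ∀ i j, i ≠ j → L ≤ ‖a i - a j‖) {q : ℝ} (hq : 0 < q) (m : ℕ) :
    ∫⁻ x, ‖∑ i ∈ Finset.range m, f (x - a i)‖ₑ ^ q = m * ∫⁻ x, ‖f x‖ₑ ^ q := by
  have h : ∀ x, ‖∑ i ∈ Finset.range m, f (x - a i)‖ₑ ^ q =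
      ∑ i ∈ Finset.range m, ‖f (x - a i)‖ₑ ^ q := fun x =>
    enorm_sum_rpow_of_pairwise _ (eq_zero_or_eq_zero_of_separated hf hL ha x _) hq
  simp_rw [h]
  rw [lintegral_finsetSum' _ fun i _ => by
    have : Continuous fun x => f (x - a i) := by fun_prop
    exact (this.enorm.measurable.pow_const q).aemeasurable]
  rw [Finset.sum_congr rfl fun i _ => lintegral_sub_right_eq_self (fun x => ‖f x‖ₑ ^ q) (a i)]
  simp

/-- Each of the `m` diagonal terms is the energy of `φ`. The condition on `L` makes every
off-diagonal interaction at most `1 / m`, hence at most one in total for each copy. -/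
theorem coulombEnergy_sumTranslates_le {α q : ℝ} (hαd : α < d) (hq : 0 < q) {φ : 𝔼 → ℝ}
    (hφ : Continuous φ) (hφ1 : ∀ x, 1 < ‖x‖ → φ x = 0) {a : ℕ → 𝔼} {L : ℝ} (hL : 4 ≤ L)
    (ha : ∀ i j, i ≠ j → L ≤ ‖a i - a j‖) {m : ℕ}
    (hm : m * (∫⁻ x, ‖φ x‖ₑ ^ q) ^ 2 ≤ ENNReal.ofReal (L / 2) ^ ((d : ℝ) - α)) :
    coulombEnergy α q (sumTranslates φ a m) ≤ m * (coulombEnergy α q φ + 1) := by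
  set c := (d : ℝ) - α with hc
  have hc0 : 0 < c := by rw [hc]; linarith
  set M := ∫⁻ x, ‖φ x‖ₑ ^ q
  have hmeas : ∀ i, Measurable fun x => ‖φ (x - a i)‖ₑ ^ q := fun i => by
    have := hφ.measurable
    fun_prop
  have hM : ∀ i, ∫⁻ x, ‖φ (x - a i)‖ₑ ^ q = M := fun i =>
    lintegral_sub_right_eq_self (fun x => ‖φ x‖ₑ ^ q) (a i)
  set P : ℕ → ℕ → ℝ≥0∞ := fun i j =>
    ∫⁻ x, ∫⁻ y, ‖φ (x - a i)‖ₑ ^ q * ‖φ (y - a j)‖ₑ ^ q / ‖x - y‖ₑ ^ c with hP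
  have hdiag : ∀ i, P i i = coulombEnergy α q φ := by
    intro i
    rw [hP]
    simp only
    rw [← lintegral_add_right_eq_self _ (a i)]
    refine lintegral_congr fun x => ?_
    rw [← lintegral_add_right_eq_self _ (a i)]
    simp [hc]
  have hoff : ∀ i j, i ≠ j → m * P i j ≤ 1 := by
    intro i j hij
    have hLc : ENNReal.ofReal (L / 2) ^ c ≠ 0 :=
      (ENNReal.rpow_pos (ENNReal.ofReal_pos.2 (by linarith)) ENNReal.ofReal_ne_top).ne'
    have hPle : P i j ≤ M ^ 2 / ENNReal.ofReal (L / 2) ^ c := by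
      calc P i j ≤ ∫⁻ x, ∫⁻ y, ‖φ (x - a i)‖ₑ ^ q * ‖φ (y - a j)‖ₑ ^ q /
              ENNReal.ofReal (L / 2) ^ c := by
            refine lintegral_mono fun x => lintegral_mono fun y => ?_
            by_cases hx : 1 < ‖x - a i‖
            · simp [hφ1 _ hx, hq]
            by_cases hy : 1 < ‖y - a j‖
            · simp [hφ1 _ hy, hq]
            -- Points in the unit balls about two different centres are at distance at least `L - 2
            -- ≥ L / 2`, because `L ≥ 4`.
            refine ENNReal.div_le_div_left (ENNReal.rpow_le_rpow ?_ hc0.le) _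
            rw [← ofReal_norm]
            refine ENNReal.ofReal_le_ofReal ?_
            have h1 := ha i j hij
            have h2 : ‖a i - a j‖ ≤ ‖x - y‖ + ‖x - a i‖ + ‖y - a j‖ := by
              calc ‖a i - a j‖ = ‖(x - y) - (x - a i) + (y - a j)‖ := by congr 1; abel
                _ ≤ ‖(x - y) - (x - a i)‖ + ‖y - a j‖ := norm_add_le _ _
                _ ≤ _ := by gcongr; exact norm_sub_le _ _
            linarith
        _ = _ := by
            generalize ENNReal.ofReal (L / 2) ^ c = D at hLc
            simp_rw [div_eq_mul_inv, mul_assoc]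
            rw [lintegral_congr fun x => lintegral_const_mul' (‖φ (x - a i)‖ₑ ^ q)
              (fun y => ‖φ (y - a j)‖ₑ ^ q * D⁻¹)
              (ENNReal.rpow_ne_top_of_nonneg hq.le enorm_ne_top)]
            rw [lintegral_mul_const' _ _ (ENNReal.inv_ne_top.2 hLc), hM,
              lintegral_mul_const _ (hmeas i), hM, sq, mul_assoc]
    calc m * P i j ≤ m * (M ^ 2 / ENNReal.ofReal (L / 2) ^ c) := by gcongr
      _ = m * M ^ 2 / ENNReal.ofReal (L / 2) ^ c := (mul_div_assoc _ _ _).symm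
      _ ≤ 1 := ENNReal.div_le_of_le_mul (by rwa [one_mul])
  have hsum : coulombEnergy α q (sumTranslates φ a m) =
      ∑ i ∈ Finset.range m, ∑ j ∈ Finset.range m, P i j := by
    have h : ∀ x, ‖sumTranslates φ a m x‖ₑ ^ q =
        ∑ i ∈ Finset.range m, ‖φ (x - a i)‖ₑ ^ q := fun x =>
      enorm_sum_rpow_of_pairwise _ (eq_zero_or_eq_zero_of_separated hφ1 hL ha x _) hq
    unfold coulombEnergy
    simp_rw [h, Finset.sum_mul_sum, div_eq_mul_inv, Finset.sum_mul]
    rw [← hc]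
    have hin : ∀ x, ∫⁻ y, ∑ i ∈ Finset.range m, ∑ j ∈ Finset.range m,
        ‖φ (x - a i)‖ₑ ^ q * ‖φ (y - a j)‖ₑ ^ q * (‖x - y‖ₑ ^ c)⁻¹ =
        ∑ i ∈ Finset.range m, ∑ j ∈ Finset.range m,
        ∫⁻ y, ‖φ (x - a i)‖ₑ ^ q * ‖φ (y - a j)‖ₑ ^ q * (‖x - y‖ₑ ^ c)⁻¹ := by
      intro x
      rw [lintegral_finsetSum _ fun i _ => by fun_prop]
      refine Finset.sum_congr rfl fun i _ => ?_
      rw [lintegral_finsetSum _ fun j _ => by fun_prop]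
    simp_rw [hin]
    rw [lintegral_finsetSum _ fun i _ => by fun_prop]
    refine Finset.sum_congr rfl fun i _ => ?_
    rw [lintegral_finsetSum _ fun j _ => by fun_prop]
    simp only [hP, div_eq_mul_inv]
  rw [hsum]
  calc _ ≤ ∑ i ∈ Finset.range m, (coulombEnergy α q φ + 1) := by
        refine Finset.sum_le_sum fun i hi => ?_
        rw [← Finset.add_sum_erase _ _ hi, hdiag]
        gcongr
        have hm0 : (m : ℝ≥0∞) ≠ 0 := by
          have := Finset.mem_range.1 hi
          exact_mod_cast (by omega : m ≠ 0)
        calc _ ≤ ∑ j ∈ (Finset.range m).erase i, (m : ℝ≥0∞)⁻¹ := by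
              refine Finset.sum_le_sum fun j hj => ?_
              rw [ENNReal.le_inv_iff_mul_le, mul_comm]
              exact hoff i j (Finset.ne_of_mem_erase hj).symm
          _ ≤ ∑ j ∈ Finset.range m, (m : ℝ≥0∞)⁻¹ :=
              Finset.sum_le_sum_of_subset (Finset.erase_subset _ _)
          _ = 1 := by
              rw [Finset.sum_const, Finset.card_range, nsmul_eq_mul,
                ENNReal.mul_inv_cancel hm0 (ENNReal.natCast_ne_top m)]
    _ = _ := by rw [Finset.sum_const, Finset.card_range, nsmul_eq_mul]

/-- Disjoint supports make the `p`-th powers additive in the local cases `s = 0` and `s = 1`. In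
between, the nonlocal interaction costs only the factor `2 ^ (p - 1)`. The constant depends neither
on the number of copies nor on their distance. -/
theorem exists_sobolevSeminorm_sumTranslates_le (hd : 1 ≤ d) {s p : ℝ} (hs₀ : 0 ≤ s) (hs₁ : s ≤ 1)
    (hp : 1 ≤ p) {φ : 𝔼 → ℝ} (hφ : ContDiff ℝ ∞ φ) (hφc : HasCompactSupport φ)
    (hφ1 : tsupport φ ⊆ closedBall 0 1) :
    ∃ K : ℝ≥0∞, K < ⊤ ∧ ∀ (a : ℕ → 𝔼) (L : ℝ), 4 ≤ L → (∀ i j, i ≠ j → L ≤ ‖a i - a j‖) →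
      ∀ m : ℕ, sobolevSeminorm s p (sumTranslates φ a m) ≤ (m * K) ^ (1 / p) := by
  have hp0 : 0 < p := by linarith
  have hsupp : ∀ x, 1 < ‖x‖ → x ∉ tsupport φ := fun x hx hx' =>
    not_lt.2 (mem_closedBall_zero_iff.1 (hφ1 hx')) hx
  have hφ0 : ∀ x, 1 < ‖x‖ → φ x = 0 := fun x hx =>
    image_eq_zero_of_notMem_tsupport (hsupp x hx)
  rcases hs₀.eq_or_lt with rfl | hs₀
  · refine ⟨_, lintegral_enorm_rpow_lt_top_of_hasCompactSupport hφ.continuous hφc hp0, ?_⟩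
    intro a L hL ha m
    simp only [sobolevSeminorm, if_true]
    rw [← lintegral_sum_translates_rpow hφ.continuous hφ0 hL ha hp0 m]
    rfl
  rcases hs₁.eq_or_lt with rfl | hs₁
  · have hφ' : ContDiff ℝ 1 φ := hφ.of_le (by simp)
    have hdc := hφ'.continuous_fderiv one_ne_zero
    refine ⟨_, lintegral_enorm_rpow_lt_top_of_hasCompactSupport hdc
      (hφc.fderiv (𝕜 := ℝ)) hp0, ?_⟩
    intro a L hL ha m
    have hd0 : ∀ x, 1 < ‖x‖ → fderiv ℝ φ x = 0 := fun x hx =>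
      image_eq_zero_of_notMem_tsupport fun h => hsupp x hx (tsupport_fderiv_subset ℝ h)
    simp only [sobolevSeminorm, one_ne_zero, if_false, if_true]
    refine (iInf₂_le _ (isWeakGradient_gradientField (contDiff_sumTranslates hφ a m)
      (hasCompactSupport_sumTranslates hφc a m))).trans (le_of_eq ?_)
    rw [← lintegral_sum_translates_rpow hdc hd0 hL ha hp0 m]
    congr 1
    refine lintegral_congr fun x => ?_
    rw [enorm_gradientField]
    congr 2
    unfold sumTranslates
    rw [fderiv_fun_sum fun i _ => ?_]
    · simp_rw [fderiv_comp_sub]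
    · have := hφ'.differentiable one_ne_zero
      fun_prop
  · have h2t : (2 : ℝ≥0∞) ^ (p - 1) ≠ ⊤ :=
      ENNReal.rpow_ne_top_of_nonneg (by linarith) ENNReal.ofNat_ne_top
    set c := (d : ℝ) + s * p with hc
    refine ⟨2 ^ (p - 1) * ∫⁻ x, ∫⁻ y, ‖φ x - φ y‖ₑ ^ p / ‖x - y‖ₑ ^ c,
      ENNReal.mul_lt_top h2t.lt_top (lintegral_gagliardo_lt_top hd hs₀ hs₁ hp hφ hφc), ?_⟩
    intro a L hL ha m
    have hφm := hφ.continuous.measurable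
    simp only [sobolevSeminorm, hs₀.ne', hs₁.ne, if_false]
    rw [← hc]
    refine ENNReal.rpow_le_rpow ?_ (by positivity)
    calc _ ≤ ∫⁻ x, ∫⁻ y, 2 ^ (p - 1) * ∑ i ∈ Finset.range m,
            ‖φ (x - a i) - φ (y - a i)‖ₑ ^ p / ‖x - y‖ₑ ^ c := by
          refine lintegral_mono fun x => lintegral_mono fun y => ?_
          simp_rw [div_eq_mul_inv]
          rw [← Finset.sum_mul, ← mul_assoc]
          refine mul_le_mul_left ?_ _
          exact enorm_sum_sub_sum_rpow_le _ (eq_zero_or_eq_zero_of_separated hφ0 hL ha x _)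
            (eq_zero_or_eq_zero_of_separated hφ0 hL ha y _) hp
      _ = 2 ^ (p - 1) * ∑ i ∈ Finset.range m,
            ∫⁻ x, ∫⁻ y, ‖φ (x - a i) - φ (y - a i)‖ₑ ^ p / ‖x - y‖ₑ ^ c := by
          simp_rw [lintegral_const_mul' _ _ h2t]
          congr 1
          have hin : ∀ x, ∫⁻ y, ∑ i ∈ Finset.range m,
              ‖φ (x - a i) - φ (y - a i)‖ₑ ^ p / ‖x - y‖ₑ ^ c =
              ∑ i ∈ Finset.range m,
                ∫⁻ y, ‖φ (x - a i) - φ (y - a i)‖ₑ ^ p / ‖x - y‖ₑ ^ c := fun x =>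
            lintegral_finsetSum _ fun i _ => by fun_prop
          simp_rw [hin]
          exact lintegral_finsetSum _ fun i _ => by fun_prop
      _ = 2 ^ (p - 1) * ∑ i ∈ Finset.range m,
            ∫⁻ x, ∫⁻ y, ‖φ x - φ y‖ₑ ^ p / ‖x - y‖ₑ ^ c := by
          congr 1
          refine Finset.sum_congr rfl fun i _ => ?_
          rw [← lintegral_add_right_eq_self _ (a i)]
          refine lintegral_congr fun x => ?_
          rw [← lintegral_add_right_eq_self _ (a i)]
          simp
      _ = _ := by
          rw [Finset.sum_const, Finset.card_range, nsmul_eq_mul]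
          ring

theorem exists_separated_sequence (hd : 1 ≤ d) {L : ℝ} (hL : 0 ≤ L) :
    ∃ a : ℕ → 𝔼, ∀ i j, i ≠ j → L ≤ ‖a i - a j‖ := by
  refine ⟨fun i => (i * L : ℝ) • EuclideanSpace.single (⟨0, hd⟩ : Fin d) (1 : ℝ), fun i j hij => ?_⟩
  simp only
  rw [← sub_smul, norm_smul, PiLp.norm_single, norm_one, mul_one, ← sub_mul, norm_mul,
    Real.norm_of_nonneg hL]
  refine le_mul_of_one_le_left hL ?_
  have h : (1 : ℤ) ≤ |(i : ℤ) - j| := Int.one_le_abs (by omega)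
  rw [Real.norm_eq_abs]
  exact_mod_cast h

theorem exists_nat_mul_rpow_lt {c k a b : ℝ} (hk : 0 < k) (hab : a < b) :
    ∃ m : ℕ, 0 < m ∧ c * (m : ℝ) ^ a < k * (m : ℝ) ^ b := by
  have h1 : Filter.Tendsto (fun m : ℕ => (m : ℝ) ^ (b - a)) Filter.atTop Filter.atTop :=
    (tendsto_rpow_atTop (sub_pos.2 hab)).comp tendsto_natCast_atTop_atTop
  obtain ⟨m, hm, hm0⟩ :=
    ((h1.eventually_gt_atTop (c / k)).and (Filter.eventually_gt_atTop 0)).exists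
  have hm0' : (0 : ℝ) < m := by exact_mod_cast hm0
  refine ⟨m, hm0, ?_⟩
  rw [div_lt_iff₀ hk, Real.rpow_sub hm0', div_mul_eq_mul_div, lt_div_iff₀ (by positivity)] at hm
  linarith

theorem exists_sobolevSeminorm_mul_coulombEnergy_lt_eLpNorm
    (hd : 1 ≤ d) {s γ p q α β₁ β₂ : ℝ} (hs₀ : 0 ≤ s) (hs₁ : s ≤ 1) (hγ : 1 < γ)
    (hp : 1 ≤ p) (hq : 1 ≤ q) (hα₀ : 0 < α) (hαd : α < d) (hβ₁ : 0 < β₁) (hβ₂ : 0 < β₂)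
    (hcond : β₁ * γ + β₂ * γ < 1) (C : ℝ≥0) :
    ∃ g : 𝔼 → ℝ, ContDiff ℝ ∞ g ∧ HasCompactSupport g ∧
      C * sobolevSeminorm s p g ^ (β₁ * p) * coulombEnergy α q g ^ β₂ <
        eLpNorm g (ENNReal.ofReal γ) volume := by
  have hp0 : 0 < p := by linarith
  have hq0 : 0 < q := by linarith
  have hγ0 : 0 < γ := by linarith
  let φ : ContDiffBump (0 : 𝔼) := ⟨1 / 2, 1, by norm_num, by norm_num⟩
  have hφ : ContDiff ℝ ∞ φ := φ.contDiff
  have hφc : HasCompactSupport φ := φ.hasCompactSupport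
  have hφs : tsupport φ ⊆ closedBall 0 1 := φ.tsupport_eq.subset
  have hφ0 : ∀ x, 1 < ‖x‖ → φ x = 0 := fun x hx =>
    image_eq_zero_of_notMem_tsupport fun hx' => not_lt.2 (mem_closedBall_zero_iff.1 (hφs hx')) hx
  obtain ⟨K, hK, hKm⟩ := exists_sobolevSeminorm_sumTranslates_le hd hs₀ hs₁ hp hφ hφc hφs
  have hQ : coulombEnergy α q φ + 1 < ⊤ := ENNReal.add_lt_top.2
    ⟨coulombEnergy_lt_top hd hα₀ hαd hq0 hφ.continuous hφc, ENNReal.one_lt_top⟩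
  have hM := lintegral_enorm_rpow_lt_top_of_hasCompactSupport hφ.continuous hφc hq0
  have hG := lintegral_enorm_rpow_lt_top_of_hasCompactSupport hφ.continuous hφc hγ0
  have hG0 : ∫⁻ x, ‖φ x‖ₑ ^ γ ≠ 0 := by
    have hmeas : Measurable fun x => ‖φ x‖ₑ ^ γ := by
      have := hφ.continuous
      fun_prop
    rw [Ne, lintegral_eq_zero_iff hmeas]
    intro h
    have h1 : volume (ball (0 : 𝔼) 1) = 0 := by
      refine measure_mono_null (fun x hx => ?_) (ae_iff.1 h)
      have : 0 < φ x := φ.pos_of_mem_ball hx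
      simp [this.ne']
    exact (measure_ball_pos volume _ one_pos).ne' h1
  set G := ∫⁻ x, ‖φ x‖ₑ ^ γ
  set Q := coulombEnergy α q φ + 1
  set M := ∫⁻ x, ‖φ x‖ₑ ^ q
  have hGr : 0 < G.toReal := ENNReal.toReal_pos hG0 hG.ne
  have hab : β₁ + β₂ < 1 / γ := by rw [lt_div_iff₀ hγ0]; linarith
  -- The number of copies is fixed first, by comparing the exponents `β₁ + β₂ < 1 / γ`; the
  -- separation `L` is then chosen depending on `m`, which is harmless because the other bounds do
  -- not depend on `L`.
  obtain ⟨m, hm0, hm⟩ := exists_nat_mul_rpow_lt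
    (c := C * K.toReal ^ β₁ * Q.toReal ^ β₂) (k := G.toReal ^ (1 / γ)) (by positivity) hab
  have hmr : (0 : ℝ) < m := by exact_mod_cast hm0
  have hc : 0 < (d : ℝ) - α := by linarith
  obtain ⟨L, hL4, hL⟩ : ∃ L : ℝ, 4 ≤ L ∧
      m * M ^ 2 ≤ ENNReal.ofReal (L / 2) ^ ((d : ℝ) - α) := by
    have ht : m * M ^ 2 ≠ ⊤ :=
      ENNReal.mul_ne_top (ENNReal.natCast_ne_top m) (ENNReal.pow_ne_top hM.ne)
    refine ⟨max 4 (2 * (m * M ^ 2).toReal ^ (1 / ((d : ℝ) - α))), le_max_left _ _, ?_⟩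
    refine (ENNReal.ofReal_toReal ht).symm.le.trans ?_
    set R := (m * M ^ 2).toReal
    have hR0 : 0 ≤ R := ENNReal.toReal_nonneg
    have h1 : R ^ (1 / ((d : ℝ) - α)) ≤ max 4 (2 * R ^ (1 / ((d : ℝ) - α))) / 2 := by
      have := le_max_right (4 : ℝ) (2 * R ^ (1 / ((d : ℝ) - α)))
      linarith
    rw [ENNReal.ofReal_rpow_of_nonneg (le_trans (by positivity) h1) hc.le]
    refine ENNReal.ofReal_le_ofReal ?_
    calc R = (R ^ (1 / ((d : ℝ) - α))) ^ ((d : ℝ) - α) := by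
          rw [← Real.rpow_mul hR0, one_div_mul_cancel hc.ne', Real.rpow_one]
      _ ≤ _ := Real.rpow_le_rpow (by positivity) h1 hc.le
  obtain ⟨a, ha⟩ := exists_separated_sequence hd (by linarith : (0 : ℝ) ≤ L)
  refine ⟨sumTranslates φ a m, contDiff_sumTranslates hφ a m,
    hasCompactSupport_sumTranslates hφc a m, ?_⟩
  have hS := hKm a L hL4 ha m
  have hE := coulombEnergy_sumTranslates_le hαd hq0 hφ.continuous hφ0 hL4 ha hL
  have hN : eLpNorm (sumTranslates φ a m) (ENNReal.ofReal γ) volume = (m * G) ^ (1 / γ) := by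
    rw [eLpNorm_eq_lintegral_rpow_enorm_toReal (by simpa using hγ0) ENNReal.ofReal_ne_top,
      ENNReal.toReal_ofReal hγ0.le, ← lintegral_sum_translates_rpow hφ.continuous hφ0 hL4 ha hγ0 m]
    rfl
  rw [hN]
  calc C * sobolevSeminorm s p (sumTranslates φ a m) ^ (β₁ * p) *
        coulombEnergy α q (sumTranslates φ a m) ^ β₂
      ≤ C * ((m * K) ^ (1 / p)) ^ (β₁ * p) * (m * Q) ^ β₂ := by gcongr
    _ = ENNReal.ofReal (C * K.toReal ^ β₁ * Q.toReal ^ β₂ * (m : ℝ) ^ (β₁ + β₂)) := by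
        have e1 : (m * K) = ENNReal.ofReal (m * K.toReal) := by
          rw [ENNReal.ofReal_mul hmr.le, ENNReal.ofReal_toReal hK.ne, ENNReal.ofReal_natCast]
        have e2 : (m * Q) = ENNReal.ofReal (m * Q.toReal) := by
          rw [ENNReal.ofReal_mul hmr.le, ENNReal.ofReal_toReal hQ.ne, ENNReal.ofReal_natCast]
        have e3 : 1 / p * (β₁ * p) = β₁ := by field_simp
        rw [← ENNReal.rpow_mul, e3, e1, e2, ENNReal.ofReal_rpow_of_nonneg (by positivity) hβ₁.le,
          ENNReal.ofReal_rpow_of_nonneg (by positivity) hβ₂.le, ← ENNReal.ofReal_coe_nnreal,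
          ← ENNReal.ofReal_mul (by positivity), ← ENNReal.ofReal_mul (by positivity),
          Real.mul_rpow hmr.le (by positivity), Real.mul_rpow hmr.le (by positivity),
          Real.rpow_add hmr]
        congr 1
        ring
    _ < ENNReal.ofReal (G.toReal ^ (1 / γ) * (m : ℝ) ^ (1 / γ)) :=
        (ENNReal.ofReal_lt_ofReal_iff (by positivity)).2 hm
    _ = _ := by
        rw [← Real.mul_rpow hGr.le hmr.le, ← ENNReal.ofReal_rpow_of_pos (by positivity),
          ENNReal.ofReal_mul hGr.le, ENNReal.ofReal_toReal hG.ne, ENNReal.ofReal_natCast, mul_comm]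

end Sharpness

theorem theorem1 (d : ℕ) (hd : 1 ≤ d) (s γ p q α β₁ β₂ : ℝ)
    (hs₀ : 0 ≤ s) (hs₁ : s ≤ 1) (hγ : 1 < γ) (hp : 1 ≤ p) (hq : 1 ≤ q)
    (hα₀ : 0 < α) (hαd : α < d) (hβ₁ : 0 < β₁) (hβ₂ : 0 < β₂)
    (hscal₁ : β₁ * p + 2 * β₂ * q = 1)
    (hscal₂ : ((d : ℝ) - s * p) * β₁ + ((d : ℝ) + α) * β₂ = d / γ) :
    (1 ≤ β₁ * γ + β₂ * γ →
      ∃ C : ℝ≥0, 0 < C ∧ ∀ g : EuclideanSpace ℝ (Fin d) → ℝ, Integrable g volume →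
        (∃ K : Set (EuclideanSpace ℝ (Fin d)), IsCompact K ∧ ∀ᵐ x ∂volume, x ∉ K → g x = 0) →
        eLpNorm g (ENNReal.ofReal γ) volume ≤
          C * sobolevSeminorm s p g ^ (β₁ * p) * coulombEnergy α q g ^ β₂) ∧
    (β₁ * γ + β₂ * γ < 1 →
      ∀ C : ℝ≥0, ∃ g : EuclideanSpace ℝ (Fin d) → ℝ, ContDiff ℝ ∞ g ∧ HasCompactSupport g ∧
        C * sobolevSeminorm s p g ^ (β₁ * p) * coulombEnergy α q g ^ β₂ <
          eLpNorm g (ENNReal.ofReal γ) volume) := by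
  refine ⟨fun hcond => ?_, fun hcond C => ?_⟩
  · obtain ⟨C, hC, h⟩ := exists_eLpNorm_le_sobolevSeminorm_mul_coulombEnergy hd hs₀ hs₁ hγ hp hq
      hα₀ hαd hβ₁ hβ₂ hscal₁ hscal₂ hcond
    exact ⟨C, hC, fun g hg _ => h g hg⟩
  · exact exists_sobolevSeminorm_mul_coulombEnergy_lt_eLpNorm hd hs₀ hs₁ hγ hp hq hα₀ hαd hβ₁ hβ₂
      hcond C
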